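/- Let $M_0$ be the set of all probability mass functions $\mathbf p=(p_0,p_1,\dots)$ on $\{0,1,2,\dots\}$ with the metric $d_0(\mathbf p,\mathbf q)=\sum_i|p_i-q_i|$, and let $\mathcal T$ be the Galton–Watson tree with offspring distribution $\mathbf p\in M_0$. Two players alternately move a token from its current vertex to a child of that vertex, starting at the root; the tree is known to both. In the normal game a player who is unable to move loses; in the misère game a player who is unable to move wins. A strategy of a player assigns a legal move to every vertex at which there is one. It is winning if that player wins whatever strategy the opponent uses, and the game is a draw if neither player has a winning strategy. Let $T\in\{0,1,2,\dots\}\cup\{\infty\}$ be the smallest $n$ such that some player has a strategy that ensures a win in at most $n$ moves, and $T=\infty$ if there is no such $n$. The path from the root to a vertex $v$ is forcing if each player has a strategy that guarantees that either this player does not lose or the game passes through $v$; let $T^*$ be the supremum of the lengths of the forcing paths. Fix one of the two games. Let $\mathcal B\subseteq M_0$ be the set of offspring distributions for which the probability of a draw is $0$, and let $\partial\mathcal B$ be its boundary in $M_0$. Then: (i) If $\mathbf p$ is in the interior of $\mathcal B$, then $\mathbb E T<\infty$ and $\mathbb E T^*<\infty$. (ii) If $\mathbf p\in\partial\mathcal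 B\cap\mathcal B$ (and, for the misère game, $p_0\neq1$), then $\mathbb E T=\infty$ and $\mathbb E T^*=\infty$. (iii) Along any sequence in $\mathcal B$ that converges in $M_0$ to a distribution $\mathbf p\in\partial\mathcal B\cap\mathcal B$ (with, for the misère game, $p_0\neq1$), we have $\mathbb E T\to\infty$ and $\mathbb E T^*\to\infty$. (iv) Along any sequence in $\mathcal B$ that converges in $M_0$ to a distribution in $\partial\mathcal B\setminus\mathcal B$, we have $\mathbb E T\to\infty$. -/

import Mathlib

open Filter Topology MeasureTheory
open scoped ENNReal

noncomputable section

/-! ### The space of offspring distributions with the `ℓ¹` metric -/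

theorem offspring_summable (p : PMF ℕ) : Summable fun i => (p i).toReal :=
  ENNReal.summable_toReal p.tsum_coe_ne_top

theorem offspring_summable_diff (p q : PMF ℕ) :
    Summable fun i => |(p i).toReal - (q i).toReal| :=
  ((offspring_summable p).sub (offspring_summable q)).abs

/-- The `ℓ¹` distance `∑ i, |p i - q i|` on probability mass functions on `ℕ`. -/
instance : MetricSpace (PMF ℕ) where
  dist p q := ∑' i, |(p i).toReal - (q i).toReal|
  dist_self p := by simp
  dist_comm p q := by simp only [abs_sub_comm]
  dist_triangle p q r := by
    rw [← (offspring_summable_diff p q).tsum_add (offspring_summable_diff q r)]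
    exact (offspring_summable_diff p r).tsum_le_tsum
      (fun i => abs_sub_le _ _ _)
      ((offspring_summable_diff p q).add (offspring_summable_diff q r))
  eq_of_dist_eq_zero := by
    intro p q h
    have h0 := (hasSum_zero_iff_of_nonneg (fun i => abs_nonneg _)).1
      (h ▸ (offspring_summable_diff p q).hasSum)
    ext i
    have h1 : |(p i).toReal - (q i).toReal| = 0 := congrFun h0 i
    exact (ENNReal.toReal_eq_toReal_iff' (p.apply_ne_top i) (q.apply_ne_top i)).1
      (sub_eq_zero.1 (abs_eq_zero.1 h1))

namespace TreeGame

/-! ### Galton-Watson trees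

Vertices are finite words (Ulam-Harris labels), the root is the empty word, and the children of
`v` are `v ++ [i]` for `i < ω v`, where `ω v` is the number of children of `v`. The values of `ω`
at words that are not vertices of the tree play no role. -/

/-- A rooted ordered tree with finite out-degrees, given by child counts. -/
abbrev Tree := List ℕ → ℕ

/-- The word `v` is a vertex of the tree `ω`. -/
def IsVertex (ω : Tree) (v : List ℕ) : Prop :=
  ∀ (u : List ℕ) (i : ℕ), u ++ [i] <+: v → i < ω u

/-- The law of the Galton-Watson tree with offspring distribution `p`: the numbers of children
are independent, each with distribution `p`. -/
def treeLaw (p : PMF ℕ) : Measure Tree :=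
  Measure.infinitePi fun _ : List ℕ => p.toMeasure

/-! ### The games -/

/-- The two rules for a player who is unable to move: in the normal game that player loses, in the
misère game that player wins. -/
inductive Rule
  | normal
  | misere

/-- The player who starts and the other player. -/
inductive Player
  | first
  | second

/-- The opponent of a player. -/
def Player.other : Player → Player
  | .first => .second
  | .second => .first

/-- The player whose turn it is after `n` moves. -/
def mover (n : ℕ) : Player := if Even n then .first else .second

/-- The winner of a game that ends after exactly `n` moves, since the player whose turn it is then
is unable to move. -/
def winner : Rule → ℕ → Player
  | .normal, n => (mover n).other
  | .misere, n => mover n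

/-- A strategy assigns a legal move to every vertex at which there is one. (A player uses it only
at the vertices where it is that player's turn.) -/
def IsStrategy (ω : Tree) (σ : List ℕ → ℕ) : Prop :=
  ∀ v, ω v ≠ 0 → σ v < ω v

/-- The position after `n` turns, when the players use the strategies `s`; the token stays where it
is once no move is possible. -/
def play (ω : Tree) (s : Player → List ℕ → ℕ) : ℕ → List ℕ
  | 0 => []
  | n + 1 =>
    if ω (play ω s n) = 0 then play ω s n
    else play ω s n ++ [s (mover n) (play ω s n)]

/-- The game ends after exactly `n` moves: at depth `n`, at a leaf. -/
def EndsAfter (ω : Tree) (s : Player → List ℕ → ℕ) (n : ℕ) : Prop :=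
  (play ω s n).length = n ∧ ω (play ω s n) = 0

/-- Player `a` wins when the players use the strategies `s`. -/
def Wins (r : Rule) (ω : Tree) (s : Player → List ℕ → ℕ) (a : Player) : Prop :=
  ∃ n, EndsAfter ω s n ∧ winner r n = a

/-- Player `a` wins after at most `k` moves when the players use the strategies `s`. -/
def WinsWithin (r : Rule) (ω : Tree) (s : Player → List ℕ → ℕ) (a : Player) (k : ℕ) : Prop :=
  ∃ n ≤ k, EndsAfter ω s n ∧ winner r n = a

/-- Player `a` has a strategy that guarantees the property `Q` of the pair of strategies used,
whatever strategy the opponent uses. -/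
def Guarantees (ω : Tree) (a : Player) (Q : (Player → List ℕ → ℕ) → Prop) : Prop :=
  ∃ σ, IsStrategy ω σ ∧
    ∀ s : Player → List ℕ → ℕ, (∀ b, IsStrategy ω (s b)) → s a = σ → Q s

/-- The game is a draw: neither player has a winning strategy. -/
def IsDraw (r : Rule) (ω : Tree) : Prop :=
  ∀ a, ¬ Guarantees ω a fun s => Wins r ω s a

/-- The probability of a draw for the offspring distribution `p`. -/
def drawProb (r : Rule) (p : PMF ℕ) : ℝ≥0∞ := treeLaw p {ω | IsDraw r ω}

/-- The set of offspring distributions for which draws have probability zero. -/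
def drawFree (r : Rule) : Set (PMF ℕ) := {p | drawProb r p = 0}

/-! ### The length of the game -/

/-- The length `T` of the game: the smallest `n` such that some player has a strategy that ensures
a win in at most `n` moves, and `∞` if there is none. -/
def gameLength (r : Rule) (ω : Tree) : ℕ∞ :=
  ⨅ (n : ℕ) (_ : ∃ a, Guarantees ω a fun s => WinsWithin r ω s a n), (n : ℕ∞)

/-- The path from the root to `v` is forcing: each player has a strategy that guarantees that they
do not lose or that the game passes through `v`. -/
def IsForcing (r : Rule) (ω : Tree) (v : List ℕ) : Prop :=
  IsVertex ω v ∧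
    ∀ a : Player, Guarantees ω a fun s => ¬ Wins r ω s a.other ∨ ∃ n, play ω s n = v

/-- `T*`: the supremum of the lengths of the forcing paths. -/
def forcingLength (r : Rule) (ω : Tree) : ℕ∞ :=
  ⨆ (v : List ℕ) (_ : IsForcing r ω v), (v.length : ℕ∞)

/-- The expectation `E T` for the offspring distribution `p`. -/
def meanGameLength (r : Rule) (p : PMF ℕ) : ℝ≥0∞ :=
  ∫⁻ ω, (gameLength r ω : ℝ≥0∞) ∂(treeLaw p)

/-- The expectation `E T*` for the offspring distribution `p`. -/
def meanForcingLength (r : Rule) (p : PMF ℕ) : ℝ≥0∞ :=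
  ∫⁻ ω, (forcingLength r ω : ℝ≥0∞) ∂(treeLaw p)

end TreeGame

end

/-!
The proof rests on generating functions. Let `g` be the offspring distribution, with the mass at
`0` removed in the misère game, let `G` be its generating function (`weight`, `gen`) and put
`F = 1 - G`, a decreasing map of `[0, 1]` to itself. By the branching property
(`treeLaw_box`) the probabilities `a n` and `1 - b n` that the player to move can force a win,
or is forced to lose, in fewer than `n` moves satisfy `a 0 = 0`, `b 0 = 1`, `a (n + 1) = F (b n)`
and `b (n + 1) = F (a n)` (`winProbIn_succ`, `notLoseProbIn_succ`). As the tree is locally finite,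
a player who can force a win can do so in a bounded number of moves, so the draw probability is
`lim b n - lim a n` (`drawProb_eq`), and `𝔼 T = ∑ (b (n + 1) - a (n + 1))` (`meanGameLength_eq`).
If draws have probability zero, the common limit `x` is a fixed point of `F`. In all cases except
the misère game on a single vertex `x < 1`, and there the size of `G' x` decides.

* If `G' x < 1`, then `F` is a contraction near `x`, for all distributions nearby. Hence the
  distribution is in the interior (`mem_interior_drawFree`), and the series for `𝔼 T` converges
  geometrically.
* If `G' x > 1` at a fixed point `x` of `F`, then the fixed point repels the iterates and draws
  have positive probability (`notMem_drawFree`).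
* If `G' x ≥ 1` and draws have probability zero, then `x > 1 / 2`, and mixing in a suitable
  distribution supported on two points yields `G' x > 1` without moving `x`. So the distribution is
  not in the interior (`notMem_interior_drawFree`).

A forcing path cannot be longer than the game, so `T* ≤ T` (`forcingLength_le_gameLength`); only a
lower bound for `T*` is needed besides. A path is forcing if no child that hangs off the path is
lost for the player to move there (`IsForcedPath.isForcing`). Let `u n` and `w n` be the
probabilities that such a path of length `n` starts at the root and that the player to move there
wins or loses, respectively, where all children off the path are required to be won. Then
`u (n + 1) = G' x * w n` and `w (n + 1) = G x - G (x - u n)`. If `G' x ≥ 1`, this gives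
`u (n + 2) ≥ u n - C (u n) ^ 2`, so `u` decays no faster than the harmonic sequence and
`𝔼 T* ≥ ∑ u (n + 1) = ∞` (`tsum_forcedWinProb_eq_top`).

All these probabilities are continuous in the offspring distribution, so along a convergent
sequence the expectations tend to `∞` by Fatou's lemma for series (`tendsto_tsum_nhds_top`). If the
limit distribution has positive draw probability, the terms of the series for `𝔼 T` there are
bounded below.
-/

namespace TreeGame

/-! ### The branching property -/

/-- The tree of descendants of `v`. -/
def subtree (ω : Tree) (v : List ℕ) : Tree := fun w => ω (v ++ w)

@[simp] lemma subtree_nil (ω : Tree) : subtree ω [] = ω := rfl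

@[simp] lemma subtree_apply_nil (ω : Tree) (v : List ℕ) : subtree ω v [] = ω v := by
  simp [subtree]

lemma subtree_subtree (ω : Tree) (v w : List ℕ) :
    subtree (subtree ω v) w = subtree ω (v ++ w) := by
  funext u; simp [subtree]

lemma measurable_subtree (v : List ℕ) : Measurable fun ω : Tree => subtree ω v :=
  measurable_pi_lambda _ fun _ => measurable_pi_apply _

lemma measurable_rootDegree : Measurable fun ω : Tree => ω [] := measurable_pi_apply _

instance (p : PMF ℕ) : IsProbabilityMeasure (treeLaw p) := by
  unfold treeLaw; infer_instance

/-- The tree whose root has `x.1` children and whose subtree at the child `i` is `x.2 i`. -/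
def graft (x : ℕ × (ℕ → Tree)) : Tree
  | [] => x.1
  | i :: v => x.2 i v

lemma measurable_graft : Measurable graft := by
  refine measurable_pi_lambda _ fun v => ?_
  cases v with
  | nil => exact measurable_fst
  | cons i v => exact (measurable_pi_apply v).comp ((measurable_pi_apply i).comp measurable_snd)

/-- The branching property: the number of children of the root and the subtrees at the words of
length one are independent, and these subtrees are again Galton-Watson trees. -/
lemma map_graft (p : PMF ℕ) :
    (p.toMeasure.prod (Measure.infinitePi fun _ : ℕ => treeLaw p)).map graft = treeLaw p := by
  classical
  refine Measure.eq_infinitePi _ fun s t ht => ?_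
  have hinj : Set.InjOn (fun x : ℕ × List ℕ => x.1 :: x.2)
      ((fun x : ℕ × List ℕ => x.1 :: x.2) ⁻¹' (s : Set (List ℕ))) := by
    rintro ⟨i, v⟩ - ⟨j, w⟩ - h
    simpa using h
  set s' := s.preimage (fun x : ℕ × List ℕ => x.1 :: x.2) hinj with hs'
  have hpre : graft ⁻¹' (Set.pi s t) = {k | [] ∈ s → k ∈ t []} ×ˢ
      ((MeasurableEquiv.curry ℕ (List ℕ) ℕ).symm ⁻¹'
        Set.pi s' (fun x : ℕ × List ℕ => t (x.1 :: x.2))) := by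
    ext ⟨k, f⟩
    simp only [Set.mem_preimage, Set.mem_pi, Finset.mem_coe, Set.mem_prod, Set.mem_ofPred_eq,
      hs', Finset.mem_preimage]
    constructor
    · intro h
      exact ⟨fun h0 => h [] h0, fun x hx => h _ hx⟩
    · rintro ⟨h0, h1⟩ v hv
      cases v with
      | nil => exact h0 hv
      | cons i v => exact h1 (i, v) hv
  have hmeas : MeasurableSet (Set.pi (s' : Set (ℕ × List ℕ))
      (fun x : ℕ × List ℕ => t (x.1 :: x.2))) :=
    MeasurableSet.pi (Finset.countable_toSet _) fun _ _ => ht _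
  rw [Measure.map_apply measurable_graft (MeasurableSet.pi (Finset.countable_toSet _)
    fun _ _ => ht _), hpre, Measure.prod_prod]
  unfold treeLaw
  rw [← Measure.map_apply (by fun_prop) hmeas,
    Measure.infinitePi_map_curry_symm (fun (_ : ℕ) (_ : List ℕ) => p.toMeasure),
    Measure.infinitePi_pi _ fun _ _ => ht _]
  have himg : s.filter (· ≠ []) = s'.image (fun x : ℕ × List ℕ => x.1 :: x.2) := by
    ext v
    cases v <;> simp [hs']
  rw [← Finset.prod_filter_mul_prod_filter_not s (· ≠ []), himg, Finset.prod_image, mul_comm]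
  · congr 1
    by_cases h0 : [] ∈ s
    · have : s.filter (fun v => ¬ v ≠ []) = {[]} := by
        ext v; simp only [Finset.mem_filter, Finset.mem_singleton, not_not]
        exact ⟨fun h => h.2, fun h => ⟨h ▸ h0, h⟩⟩
      rw [this]; simp [h0]
    · have : s.filter (fun v => ¬ v ≠ []) = ∅ := by
        ext v; simp only [Finset.mem_filter, Finset.notMem_empty, not_not, iff_false]
        rintro ⟨h1, rfl⟩; exact h0 h1
      rw [this]; simp [h0]
  · rintro ⟨i, v⟩ - ⟨j, w⟩ - h
    simpa using h

lemma treeLaw_box (p : PMF ℕ) (k : ℕ) (A : ℕ → Set Tree) (hA : ∀ i, MeasurableSet (A i)) :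
    treeLaw p {ω | ω [] = k ∧ ∀ i < k, subtree ω [i] ∈ A i} =
      p k * ∏ i ∈ Finset.range k, treeLaw p (A i) := by
  have hm : MeasurableSet {ω : Tree | ω [] = k ∧ ∀ i < k, subtree ω [i] ∈ A i} := by
    refine measurableSet_setOfPred.2 (Measurable.and ?_ (Measurable.forall fun i =>
      Measurable.imp measurable_const ?_))
    · exact measurableSet_setOfPred.1 (measurable_rootDegree (measurableSet_singleton k))
    · exact measurableSet_setOfPred.1 (measurable_subtree [i] (hA i))
  have hpre : graft ⁻¹' {ω : Tree | ω [] = k ∧ ∀ i < k, subtree ω [i] ∈ A i} =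
      {k} ×ˢ Set.pi (Finset.range k) A := by
    ext ⟨j, f⟩
    have : ∀ i, subtree (graft (j, f)) [i] = f i := fun i => by
      funext v; simp [subtree, graft]
    simp [this, graft]
  rw [← map_graft p, Measure.map_apply measurable_graft hm, hpre, Measure.prod_prod,
    PMF.toMeasure_apply_singleton _ _ (measurableSet_singleton k),
    Measure.infinitePi_pi _ fun i _ => hA i, map_graft]


lemma measurableSet_forall_subtree {A : Set Tree} (hA : MeasurableSet A) :
    MeasurableSet {ω : Tree | ∀ i < ω [], subtree ω [i] ∈ A} :=
  measurableSet_setOfPred.2 <| Measurable.forall fun i => Measurable.imp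
    (measurableSet_setOfPred.1 (measurableSet_lt measurable_const measurable_rootDegree))
    (measurableSet_setOfPred.1 (measurable_subtree [i] hA))

lemma measurableSet_exists_unique_subtree {A B : Set Tree} (hA : MeasurableSet A)
    (hB : MeasurableSet B) :
    MeasurableSet {ω : Tree | ∃ i < ω [], subtree ω [i] ∈ A ∧
      ∀ j < ω [], j ≠ i → subtree ω [j] ∈ B} :=
  measurableSet_setOfPred.2 <| Measurable.exists fun i => Measurable.and
    (measurableSet_setOfPred.1 (measurableSet_lt measurable_const measurable_rootDegree))
    (Measurable.and (measurableSet_setOfPred.1 (measurable_subtree [i] hA))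
      (Measurable.forall fun j => Measurable.imp
        (measurableSet_setOfPred.1 (measurableSet_lt measurable_const measurable_rootDegree))
        (Measurable.imp measurable_const (measurableSet_setOfPred.1 (measurable_subtree [j] hB)))))

lemma measurableSet_rootDegree (K : Set ℕ) : MeasurableSet {ω : Tree | ω [] ∈ K} :=
  measurable_rootDegree .of_discrete

lemma measureReal_eq_tsum_rootDegree (p : PMF ℕ) {S : Set Tree} (hS : MeasurableSet S) :
    (treeLaw p).real S = ∑' k, (treeLaw p).real {ω | ω [] = k ∧ ω ∈ S} := by
  have hU : S = ⋃ k, {ω : Tree | ω [] = k ∧ ω ∈ S} := by ext ω; simp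
  have h := measure_iUnion (μ := treeLaw p) (f := fun k => {ω : Tree | ω [] = k ∧ ω ∈ S})
    (fun j k hjk => Set.disjoint_left.2 fun ω h1 h2 => hjk (h1.1.symm.trans h2.1))
    (fun k => (measurableSet_rootDegree {k}).inter hS)
  rw [← hU] at h
  simp only [measureReal_def]
  rw [h, ENNReal.tsum_toReal_eq fun k => measure_ne_top _ _]

/-- The probability that the number of children of the root is in `K` and all the subtrees at
these children are in `A`. -/
lemma measureReal_forall_subtree (p : PMF ℕ) (K : Set ℕ) [DecidablePred (· ∈ K)] {A : Set Tree}
    (hA : MeasurableSet A) :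
    (treeLaw p).real {ω | ω [] ∈ K ∧ ∀ i < ω [], subtree ω [i] ∈ A} =
      ∑' k, (if k ∈ K then (p k).toReal else 0) * (treeLaw p).real A ^ k := by
  have hm : MeasurableSet {ω : Tree | ω [] ∈ K ∧ ∀ i < ω [], subtree ω [i] ∈ A} :=
    (measurableSet_rootDegree K).inter (measurableSet_forall_subtree hA)
  rw [measureReal_eq_tsum_rootDegree p hm]
  congr 1
  funext k
  split_ifs with hk
  · have : {ω : Tree | ω [] = k ∧ ω ∈ {ω : Tree | ω [] ∈ K ∧
        ∀ i < ω [], subtree ω [i] ∈ A}} =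
        {ω : Tree | ω [] = k ∧ ∀ i < k, subtree ω [i] ∈ A} := by
      ext ω
      simp only [Set.mem_ofPred_eq]
      constructor
      · rintro ⟨rfl, -, h⟩; exact ⟨rfl, h⟩
      · rintro ⟨rfl, h⟩; exact ⟨rfl, hk, h⟩
    rw [this, measureReal_def, treeLaw_box p k (fun _ => A) fun _ => hA]
    simp [measureReal_def]
  · have : {ω : Tree | ω [] = k ∧ ω ∈ {ω : Tree | ω [] ∈ K ∧
        ∀ i < ω [], subtree ω [i] ∈ A}} = ∅ := by
      ext ω
      simp only [Set.mem_ofPred_eq, Set.mem_empty_iff_false, iff_false]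
      rintro ⟨rfl, h, -⟩; exact hk h
    rw [this]; simp

/-- The probability that, among the subtrees at the children of the root, one is in `A` and all
the others are in the disjoint set `B`. -/
lemma measureReal_exists_unique_subtree (p : PMF ℕ) {A B : Set Tree} (hA : MeasurableSet A)
    (hB : MeasurableSet B) (hAB : Disjoint A B) :
    (treeLaw p).real {ω | ∃ i < ω [], subtree ω [i] ∈ A ∧
      ∀ j < ω [], j ≠ i → subtree ω [j] ∈ B} =
      ∑' k : ℕ, (p k).toReal *
        (k * ((treeLaw p).real A * (treeLaw p).real B ^ (k - 1))) := by
  classical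
  rw [measureReal_eq_tsum_rootDegree p (measurableSet_exists_unique_subtree hA hB)]
  congr 1
  funext k
  let S : ℕ → Set Tree := fun i =>
    {ω | ω [] = k ∧ ∀ j < k, subtree ω [j] ∈ if j = i then A else B}
  have hU : {ω : Tree | ω [] = k ∧ ω ∈ {ω : Tree | ∃ i < ω [], subtree ω [i] ∈ A ∧
      ∀ j < ω [], j ≠ i → subtree ω [j] ∈ B}} = ⋃ i ∈ Finset.range k, S i := by
    ext ω
    simp only [Set.mem_ofPred_eq, Set.mem_iUnion, Finset.mem_range, S, exists_prop]
    constructor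
    · rintro ⟨rfl, i, hi, h1, h2⟩
      refine ⟨i, hi, rfl, fun j hj => ?_⟩
      split_ifs with h
      · exact h ▸ h1
      · exact h2 j hj h
    · rintro ⟨i, hi, rfl, h⟩
      refine ⟨rfl, i, hi, by simpa using h i hi, fun j hj hne => by simpa [hne] using h j hj⟩
  have hm : ∀ i j : ℕ, MeasurableSet (if j = i then A else B) := fun i j => by
    split_ifs <;> assumption
  have hS : ∀ i, MeasurableSet (S i) := fun i => by
    refine measurableSet_setOfPred.2 (Measurable.and ?_ (Measurable.forall fun j =>
      Measurable.imp measurable_const ?_))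
    · exact measurableSet_setOfPred.1 (measurable_rootDegree (measurableSet_singleton k))
    · exact measurableSet_setOfPred.1 (measurable_subtree [j] (hm i j))
  rw [hU, measureReal_biUnion_finset _ fun i _ => hS i]
  · have : ∀ i ∈ Finset.range k, (treeLaw p).real (S i) =
        (p k).toReal * ((treeLaw p).real A * (treeLaw p).real B ^ (k - 1)) := by
      intro i hi
      rw [measureReal_def, treeLaw_box p k (fun j => if j = i then A else B) (hm i),
        ← Finset.mul_prod_erase _ _ hi]
      rw [Finset.prod_congr rfl (g := fun _ => treeLaw p B)
        (fun j hj => by rw [if_neg (Finset.ne_of_mem_erase hj)])]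
      simp [measureReal_def, Finset.card_erase_of_mem hi]
    rw [Finset.sum_congr rfl this]
    simp; ring
  · intro i hi j hj hij
    refine Set.disjoint_left.2 fun ω h1 h2 => ?_
    have h1' := h1.2 i (by simpa using hi)
    have h2' := h2.2 i (by simpa using hi)
    rw [if_pos rfl] at h1'
    rw [if_neg hij] at h2'
    exact Set.disjoint_left.1 hAB h1' h2'

end TreeGame

namespace TreeGame

/-! ### Positions that are won or lost in a bounded number of moves -/

mutual

/-- The player to move at the root of `ω` can force a win in fewer than `n` moves. -/
def WinsIn (r : Rule) : ℕ → Tree → Prop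
  | 0, _ => False
  | n + 1, ω => (r = .misere ∧ ω [] = 0) ∨ ∃ i < ω [], LosesIn r n (subtree ω [i])

/-- The opponent of the player to move at the root of `ω` can force a win in fewer than `n`
moves. -/
def LosesIn (r : Rule) : ℕ → Tree → Prop
  | 0, _ => False
  | n + 1, ω => ¬ (r = .misere ∧ ω [] = 0) ∧ ∀ i < ω [], WinsIn r n (subtree ω [i])

end

/-- The player to move at the root of `ω` can force a win in a bounded number of moves. -/
def MoverWins (r : Rule) (ω : Tree) : Prop := ∃ n, WinsIn r n ω

/-- The opponent of the player to move at the root of `ω` can force a win in a bounded number of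
moves. -/
def MoverLoses (r : Rule) (ω : Tree) : Prop := ∃ n, LosesIn r n ω

variable {r : Rule} {ω : Tree}

@[simp] lemma not_winsIn_zero : ¬ WinsIn r 0 ω := by simp [WinsIn]

@[simp] lemma not_losesIn_zero : ¬ LosesIn r 0 ω := by simp [LosesIn]

lemma winsIn_succ_subtree {n : ℕ} {v : List ℕ} : WinsIn r (n + 1) (subtree ω v) ↔
    (r = .misere ∧ ω v = 0) ∨ ∃ i < ω v, LosesIn r n (subtree ω (v ++ [i])) := by
  simp [WinsIn, subtree_subtree]

lemma losesIn_succ_subtree {n : ℕ} {v : List ℕ} : LosesIn r (n + 1) (subtree ω v) ↔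
    ¬ (r = .misere ∧ ω v = 0) ∧ ∀ i < ω v, WinsIn r n (subtree ω (v ++ [i])) := by
  simp [LosesIn, subtree_subtree]

lemma winsIn_losesIn_succ (n : ℕ) : ∀ ω : Tree,
    (WinsIn r n ω → WinsIn r (n + 1) ω) ∧ (LosesIn r n ω → LosesIn r (n + 1) ω) := by
  induction n with
  | zero => simp
  | succ n ih =>
    refine fun ω => ⟨fun h => ?_, fun h => ?_⟩
    · rw [WinsIn] at h ⊢
      exact h.imp_right fun ⟨i, hi, hl⟩ => ⟨i, hi, (ih _).2 hl⟩
    · rw [LosesIn] at h ⊢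
      exact ⟨h.1, fun i hi => (ih _).1 (h.2 i hi)⟩

lemma WinsIn.mono {m n : ℕ} (hmn : m ≤ n) (h : WinsIn r m ω) : WinsIn r n ω := by
  induction hmn with
  | refl => exact h
  | step _ ih => exact (winsIn_losesIn_succ _ _).1 ih

lemma LosesIn.mono {m n : ℕ} (hmn : m ≤ n) (h : LosesIn r m ω) : LosesIn r n ω := by
  induction hmn with
  | refl => exact h
  | step _ ih => exact (winsIn_losesIn_succ _ _).2 ih

lemma not_winsIn_and_losesIn (n : ℕ) : ∀ ω : Tree, ¬ (WinsIn r n ω ∧ LosesIn r n ω) := by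
  induction n with
  | zero => simp
  | succ n ih =>
    rintro ω ⟨h1, h2⟩
    rw [WinsIn] at h1
    rw [LosesIn] at h2
    rcases h1 with h1 | ⟨i, hi, h⟩
    · exact h2.1 h1
    · exact ih _ ⟨h2.2 i hi, h⟩

lemma MoverWins.not_moverLoses (h : MoverWins r ω) : ¬ MoverLoses r ω := by
  rintro ⟨m, hm⟩
  obtain ⟨n, hn⟩ := h
  exact not_winsIn_and_losesIn (max m n) ω
    ⟨hn.mono (le_max_right _ _), hm.mono (le_max_left _ _)⟩

lemma moverWins_subtree {v : List ℕ} : MoverWins r (subtree ω v) ↔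
    (r = .misere ∧ ω v = 0) ∨ ∃ i < ω v, MoverLoses r (subtree ω (v ++ [i])) := by
  constructor
  · rintro ⟨_ | n, h⟩
    · simp at h
    · exact (winsIn_succ_subtree.1 h).imp_right fun ⟨i, hi, hl⟩ => ⟨i, hi, n, hl⟩
  · rintro (h | ⟨i, hi, n, h⟩)
    · exact ⟨1, winsIn_succ_subtree.2 (.inl h)⟩
    · exact ⟨n + 1, winsIn_succ_subtree.2 (.inr ⟨i, hi, h⟩)⟩

/-- Since a vertex has finitely many children, the lengths of the wins at the children are bounded.
-/
lemma moverLoses_subtree {v : List ℕ} : MoverLoses r (subtree ω v) ↔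
    ¬ (r = .misere ∧ ω v = 0) ∧ ∀ i < ω v, MoverWins r (subtree ω (v ++ [i])) := by
  constructor
  · rintro ⟨_ | n, h⟩
    · simp at h
    · exact ⟨(losesIn_succ_subtree.1 h).1, fun i hi => ⟨n, (losesIn_succ_subtree.1 h).2 i hi⟩⟩
  · rintro ⟨h0, h⟩
    choose! f hf using h
    refine ⟨(Finset.range (ω v)).sup f + 1, losesIn_succ_subtree.2 ⟨h0, fun i hi => ?_⟩⟩
    exact (hf i hi).mono (Finset.le_sup (Finset.mem_range.2 hi))

lemma moverWins_iff : MoverWins r ω ↔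
    (r = .misere ∧ ω [] = 0) ∨ ∃ i < ω [], MoverLoses r (subtree ω [i]) :=
  moverWins_subtree (v := [])

lemma moverLoses_iff : MoverLoses r ω ↔
    ¬ (r = .misere ∧ ω [] = 0) ∧ ∀ i < ω [], MoverWins r (subtree ω [i]) :=
  moverLoses_subtree (v := [])

/-! ### Strategies -/

lemma mover_succ (n : ℕ) : mover (n + 1) = (mover n).other := by
  unfold mover
  rcases Nat.even_or_odd n with h | h
  · simp [h, Nat.even_add_one, Player.other]
  · simp [Nat.not_even_iff_odd.2 h, Nat.even_add_one, Player.other]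

lemma other_eq_iff {a b : Player} : a.other = b ↔ a ≠ b := by
  cases a <;> cases b <;> simp [Player.other]

lemma mover_succ_eq_iff {n : ℕ} {a : Player} : mover (n + 1) = a ↔ mover n ≠ a := by
  rw [mover_succ, other_eq_iff]

lemma winner_eq_iff {n : ℕ} {a : Player} : winner r n = a ↔ (mover n = a ↔ r = .misere) := by
  cases r <;> simp [winner, other_eq_iff]

section play

variable {s : Player → List ℕ → ℕ}

lemma play_length_or (n : ℕ) : (play ω s n).length = n ∨
    ∃ m < n, EndsAfter ω s m ∧ play ω s n = play ω s m := by
  induction n with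
  | zero => simp [play]
  | succ n ih =>
    by_cases h0 : ω (play ω s n) = 0
    · have hp : play ω s (n + 1) = play ω s n := by simp [play, h0]
      right
      rcases ih with ih | ⟨m, hm, he, h⟩
      · exact ⟨n, n.lt_succ_self, ⟨ih, h0⟩, hp⟩
      · exact ⟨m, hm.trans n.lt_succ_self, he, hp.trans h⟩
    · left
      rcases ih with ih | ⟨m, hm, he, h⟩
      · simp [play, h0, ih]
      · exact absurd (h ▸ he.2) h0

lemma play_prefix_succ (n : ℕ) : play ω s n <+: play ω s (n + 1) := by
  rw [play]; split_ifs <;> simp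

lemma play_prefix {m n : ℕ} (h : m ≤ n) : play ω s m <+: play ω s n := by
  induction h with
  | refl => exact List.prefix_refl _
  | step _ ih => exact ih.trans (play_prefix_succ _)

lemma EndsAfter.play_eq {m n : ℕ} (h : EndsAfter ω s m) (hmn : m ≤ n) :
    play ω s n = play ω s m := by
  induction hmn with
  | refl => rfl
  | step _ ih => rw [play, ih, if_pos h.2]

end play

lemma Guarantees.mono {a : Player} {Q Q' : (Player → List ℕ → ℕ) → Prop}
    (h : Guarantees ω a Q) (hQ : ∀ s, Q s → Q' s) : Guarantees ω a Q' :=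
  let ⟨σ, hσ, h⟩ := h
  ⟨σ, hσ, fun s hs hsa => hQ s (h s hs hsa)⟩

/-- If each player has a guarantee, the two strategies can be played against each other. -/
lemma Guarantees.exists_and {a : Player} {Q Q' : (Player → List ℕ → ℕ) → Prop}
    (h : Guarantees ω a Q) (h' : Guarantees ω a.other Q') : ∃ s, Q s ∧ Q' s := by
  classical
  obtain ⟨σ, hσ, h⟩ := h
  obtain ⟨τ, hτ, h'⟩ := h'
  cases a
  · let s : Player → List ℕ → ℕ := fun b => Player.rec σ τ b
    have hs : ∀ b, IsStrategy ω (s b) := by rintro (_ | _) <;> assumption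
    exact ⟨s, h s hs rfl, h' s hs rfl⟩
  · let s : Player → List ℕ → ℕ := fun b => Player.rec τ σ b
    have hs : ∀ b, IsStrategy ω (s b) := by rintro (_ | _) <;> assumption
    exact ⟨s, h s hs rfl, h' s hs rfl⟩

/-- A property of positions that a player can preserve at every own move, and that the opponent
cannot destroy, can be guaranteed for the whole game. -/
lemma guarantees_invariant {a : Player} {I : List ℕ → Prop} (h0 : I [])
    (hown : ∀ v, I v → ω v ≠ 0 → mover v.length = a → ∃ i < ω v, I (v ++ [i]))
    (hother : ∀ v, I v → mover v.length ≠ a → ∀ i < ω v, I (v ++ [i])) :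
    Guarantees ω a fun s => ∀ n, I (play ω s n) := by
  classical
  let σ : List ℕ → ℕ := fun v => if h : ∃ i < ω v, I (v ++ [i]) then h.choose else 0
  refine ⟨σ, fun v hv => ?_, fun s hs hsa n => ?_⟩
  · by_cases h : ∃ i < ω v, I (v ++ [i])
    · simpa [σ, h] using h.choose_spec.1
    · simpa [σ, h] using Nat.pos_of_ne_zero hv
  · induction n with
    | zero => exact h0
    | succ n ih =>
      rw [play]
      split_ifs with hz
      · exact ih
      · have hlen : (play ω s n).length = n := by
          rcases play_length_or (ω := ω) (s := s) n with h | ⟨m, -, he, h⟩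
          · exact h
          · exact absurd (h ▸ he.2) hz
        by_cases hm : mover n = a
        · have h := hown _ ih hz (by rwa [hlen])
          have : s (mover n) (play ω s n) = h.choose := by
            rw [hm, hsa]; simp only [σ]; rw [dif_pos h]
          rw [this]
          exact h.choose_spec.2
        · exact hother _ ih (by rwa [hlen]) _ (hs _ _ hz)

/-- The position `v` is won for the player `a` in fewer than `n` further moves. -/
def WonFor (r : Rule) (ω : Tree) (a : Player) (n : ℕ) (v : List ℕ) : Prop :=
  (mover v.length = a → WinsIn r n (subtree ω v)) ∧
    (mover v.length ≠ a → LosesIn r n (subtree ω v))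

variable {a : Player}

lemma not_wonFor_zero {v : List ℕ} : ¬ WonFor r ω a 0 v := by
  intro h
  by_cases hm : mover v.length = a
  · simpa using h.1 hm
  · simpa using h.2 hm

/-- A leaf counts as a position won in fewer than `n + 1` moves exactly for the player who wins
there. -/
lemma wonFor_leaf {n : ℕ} {v : List ℕ} (hv : ω v = 0) :
    WonFor r ω a (n + 1) v ↔ winner r v.length = a := by
  rw [winner_eq_iff, WonFor, winsIn_succ_subtree, losesIn_succ_subtree]
  simp only [hv, and_true, not_lt_zero, false_and, exists_false, or_false, false_imp_iff,
    implies_true]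
  tauto

lemma WonFor.exists_child {n : ℕ} {v : List ℕ} (h : WonFor r ω a (n + 1) v) (hv : ω v ≠ 0)
    (hm : mover v.length = a) : ∃ i < ω v, WonFor r ω a n (v ++ [i]) := by
  obtain ⟨i, hi, hl⟩ := (winsIn_succ_subtree.1 (h.1 hm)).resolve_left fun h => hv h.2
  refine ⟨i, hi, fun h' => ?_, fun _ => hl⟩
  rw [List.length_append, List.length_singleton, mover_succ_eq_iff] at h'
  exact absurd hm h'

lemma WonFor.child {n : ℕ} {v : List ℕ} (h : WonFor r ω a (n + 1) v)
    (hm : mover v.length ≠ a) {i : ℕ} (hi : i < ω v) : WonFor r ω a n (v ++ [i]) := by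
  refine ⟨fun _ => (losesIn_succ_subtree.1 (h.2 hm)).2 i hi, fun h' => ?_⟩
  rw [List.length_append, List.length_singleton, Ne, mover_succ_eq_iff] at h'
  exact absurd hm h'

lemma wonFor_of_exists_child {n : ℕ} {v : List ℕ} (hm : mover v.length = a) {i : ℕ}
    (hi : i < ω v) (h : WonFor r ω a n (v ++ [i])) : WonFor r ω a (n + 1) v := by
  refine ⟨fun _ => winsIn_succ_subtree.2 (.inr ⟨i, hi, h.2 ?_⟩), fun h' => absurd hm h'⟩
  rw [List.length_append, List.length_singleton, Ne, mover_succ_eq_iff]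
  exact fun h => h hm

lemma wonFor_of_forall_child {n : ℕ} {v : List ℕ} (hm : mover v.length ≠ a) (hv : ω v ≠ 0)
    (h : ∀ i < ω v, WonFor r ω a n (v ++ [i])) : WonFor r ω a (n + 1) v := by
  refine ⟨fun h' => absurd h' hm, fun _ => losesIn_succ_subtree.2 ⟨fun h => hv h.2, fun i hi =>
    (h i hi).1 ?_⟩⟩
  rw [List.length_append, List.length_singleton, mover_succ_eq_iff]
  exact hm

lemma WonFor.guarantees {n : ℕ} (h : WonFor r ω a (n + 1) []) :
    Guarantees ω a fun s => WinsWithin r ω s a n := by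
  refine Guarantees.mono (guarantees_invariant (I := fun v => WonFor r ω a (n + 1 - v.length) v)
    (by simpa using h) ?_ ?_) ?_
  · intro v hI hv hm
    obtain ⟨k, hk⟩ : ∃ k, n + 1 - v.length = k + 1 :=
      Nat.exists_eq_succ_of_ne_zero fun h0 => not_wonFor_zero (h0 ▸ hI)
    rw [hk] at hI
    obtain ⟨i, hi, h⟩ := hI.exists_child hv hm
    refine ⟨i, hi, ?_⟩
    rwa [List.length_append, List.length_singleton, show n + 1 - (v.length + 1) = k by omega]
  · intro v hI hm i hi
    obtain ⟨k, hk⟩ : ∃ k, n + 1 - v.length = k + 1 :=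
      Nat.exists_eq_succ_of_ne_zero fun h0 => not_wonFor_zero (h0 ▸ hI)
    rw [hk] at hI
    rw [List.length_append, List.length_singleton, show n + 1 - (v.length + 1) = k by omega]
    exact hI.child hm hi
  · intro s hs
    rcases play_length_or (ω := ω) (s := s) (n + 1) with hl | ⟨m, hm, he, hp⟩
    · have := hs (n + 1)
      rw [hl, Nat.sub_self] at this
      exact absurd this not_wonFor_zero
    · refine ⟨m, Nat.le_of_lt_succ hm, he, ?_⟩
      have h1 := hs m
      rw [he.1, show n + 1 - m = (n - m) + 1 by omega, wonFor_leaf he.2, he.1] at h1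
      exact h1

lemma guarantees_not_winsWithin {n : ℕ} (h : ¬ WonFor r ω a (n + 1) []) :
    Guarantees ω a.other fun s => ¬ WinsWithin r ω s a n := by
  refine Guarantees.mono (guarantees_invariant (I := fun v => ¬ WonFor r ω a (n + 1 - v.length) v)
    (by simpa using h) ?_ ?_) ?_
  · intro v hI hv hm
    by_contra! hc
    rw [eq_comm, other_eq_iff] at hm
    refine hI ?_
    have h0 := hc 0 (Nat.pos_of_ne_zero hv)
    rw [List.length_append, List.length_singleton] at h0
    obtain ⟨k, hk⟩ : ∃ k, n + 1 - (v.length + 1) = k := ⟨_, rfl⟩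
    rw [hk] at h0
    have hk0 : k ≠ 0 := by rintro rfl; exact not_wonFor_zero h0
    rw [show n + 1 - v.length = k + 1 by omega]
    refine wonFor_of_forall_child (Ne.symm hm) hv fun i hi => ?_
    have := hc i hi
    rwa [List.length_append, List.length_singleton, hk] at this
  · intro v hI hm i hi hc
    rw [List.length_append, List.length_singleton] at hc
    have hm' : mover v.length = a := by
      by_contra h; exact hm (other_eq_iff.2 (Ne.symm h)).symm
    obtain ⟨k, hk⟩ : ∃ k, n + 1 - (v.length + 1) = k := ⟨_, rfl⟩
    rw [hk] at hc
    have hk0 : k ≠ 0 := by rintro rfl; exact not_wonFor_zero hc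
    refine hI ?_
    rw [show n + 1 - v.length = k + 1 by omega]
    exact wonFor_of_exists_child hm' hi hc
  · rintro s hs ⟨m, hm, he, hw⟩
    refine hs m ?_
    rwa [he.1, show n + 1 - m = (n - m) + 1 by omega, wonFor_leaf he.2, he.1]

/-- The position `v` is won for the player `a` in a bounded number of moves. -/
def EventuallyWonFor (r : Rule) (ω : Tree) (a : Player) (v : List ℕ) : Prop :=
  (mover v.length = a → MoverWins r (subtree ω v)) ∧
    (mover v.length ≠ a → MoverLoses r (subtree ω v))

lemma eventuallyWonFor_leaf {v : List ℕ} (hv : ω v = 0) :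
    EventuallyWonFor r ω a v ↔ winner r v.length = a := by
  rw [winner_eq_iff, EventuallyWonFor, moverWins_subtree, moverLoses_subtree]
  simp only [hv, and_true, not_lt_zero, false_and, exists_false, or_false, false_imp_iff,
    implies_true]
  tauto

lemma eventuallyWonFor_iff_exists {v : List ℕ} :
    EventuallyWonFor r ω a v ↔ ∃ n, WonFor r ω a n v := by
  by_cases hm : mover v.length = a
  · simp [EventuallyWonFor, WonFor, hm, MoverWins]
  · simp [EventuallyWonFor, WonFor, hm, MoverLoses]

lemma exists_child_not_eventuallyWonFor {v : List ℕ} (h : ¬ EventuallyWonFor r ω a v)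
    (hv : ω v ≠ 0) (hm : mover v.length ≠ a) :
    ∃ i < ω v, ¬ EventuallyWonFor r ω a (v ++ [i]) := by
  by_contra! hc
  refine h ⟨fun h => absurd h hm, fun _ => moverLoses_subtree.2 ⟨fun h => hv h.2, fun i hi =>
    (hc i hi).1 ?_⟩⟩
  rw [List.length_append, List.length_singleton, mover_succ_eq_iff]
  exact hm

lemma child_not_eventuallyWonFor {v : List ℕ} (h : ¬ EventuallyWonFor r ω a v)
    (hm : mover v.length = a) {i : ℕ} (hi : i < ω v) :
    ¬ EventuallyWonFor r ω a (v ++ [i]) := by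
  intro hc
  refine h ⟨fun _ => moverWins_subtree.2 (.inr ⟨i, hi, hc.2 ?_⟩), fun h' => absurd hm h'⟩
  rw [List.length_append, List.length_singleton, Ne, mover_succ_eq_iff]
  exact fun h => h hm

lemma guarantees_not_wins (h : ¬ EventuallyWonFor r ω a []) :
    Guarantees ω a.other fun s => ¬ Wins r ω s a := by
  refine Guarantees.mono (guarantees_invariant (I := fun v => ¬ EventuallyWonFor r ω a v)
    h ?_ ?_) ?_
  · intro v hI hv hm
    rw [eq_comm, other_eq_iff] at hm
    exact exists_child_not_eventuallyWonFor hI hv hm.symm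
  · intro v hI hm i hi
    exact child_not_eventuallyWonFor hI
      (by by_contra h; exact hm (other_eq_iff.2 (Ne.symm h)).symm) hi
  · rintro s hs ⟨m, he, hw⟩
    refine hs m ?_
    rwa [eventuallyWonFor_leaf he.2, he.1]

lemma guarantees_winsWithin_iff {n : ℕ} :
    (Guarantees ω a fun s => WinsWithin r ω s a n) ↔ WonFor r ω a (n + 1) [] := by
  refine ⟨fun h => ?_, WonFor.guarantees⟩
  by_contra hc
  obtain ⟨s, h1, h2⟩ := h.exists_and (guarantees_not_winsWithin hc)
  exact h2 h1

lemma guarantees_wins_iff :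
    (Guarantees ω a fun s => Wins r ω s a) ↔ EventuallyWonFor r ω a [] := by
  refine ⟨fun h => ?_, fun h => ?_⟩
  · by_contra hc
    obtain ⟨s, h1, h2⟩ := h.exists_and (guarantees_not_wins hc)
    exact h2 h1
  · obtain ⟨n, hn⟩ := eventuallyWonFor_iff_exists.1 h
    have hn' : WonFor r ω a (n + 1) [] :=
      ⟨fun hm => (hn.1 hm).mono n.le_succ, fun hm => (hn.2 hm).mono n.le_succ⟩
    exact hn'.guarantees.mono fun s ⟨m, _, h⟩ => ⟨m, h⟩

lemma exists_wonFor_nil {n : ℕ} :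
    (∃ a, WonFor r ω a n []) ↔ WinsIn r n ω ∨ LosesIn r n ω := by
  have h0 : mover ([] : List ℕ).length = Player.first := by simp [mover]
  constructor
  · rintro ⟨_ | _, h⟩
    · exact .inl (h.1 h0)
    · exact .inr (h.2 (by simp [mover]))
  · rintro (h | h)
    · exact ⟨.first, fun _ => h, fun h' => absurd h0 h'⟩
    · exact ⟨.second, fun h' => by simp [mover] at h', fun _ => h⟩

/-- There is a draw if and only if no player can force a win in a bounded number of moves. -/
lemma isDraw_iff : IsDraw r ω ↔ ¬ MoverWins r ω ∧ ¬ MoverLoses r ω := by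
  have h0 : mover ([] : List ℕ).length = Player.first := by simp [mover]
  simp only [IsDraw, guarantees_wins_iff]
  constructor
  · intro h
    exact ⟨fun hw => h .first ⟨fun _ => hw, fun h' => absurd h0 h'⟩,
      fun hl => h .second ⟨fun h' => by simp [mover] at h', fun _ => hl⟩⟩
  · rintro ⟨h1, h2⟩ (_ | _) h
    · exact h1 (h.1 h0)
    · exact h2 (h.2 (by simp [mover]))

lemma lt_gameLength_iff {n : ℕ} :
    (n : ℕ∞) < gameLength r ω ↔ ¬ WinsIn r (n + 1) ω ∧ ¬ LosesIn r (n + 1) ω := by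
  rw [← not_or, ← not_le, not_iff_not, gameLength]
  simp only [guarantees_winsWithin_iff, exists_wonFor_nil]
  constructor
  · intro h
    by_contra hc
    have : ((n + 1 : ℕ) : ℕ∞) ≤ ⨅ (k : ℕ) (_ : WinsIn r (k + 1) ω ∨ LosesIn r (k + 1) ω),
        (k : ℕ∞) := by
      refine le_iInf₂ fun k hk => ?_
      by_contra hlt
      rw [Nat.cast_le, not_le] at hlt
      exact hc (hk.imp (WinsIn.mono (by omega)) (LosesIn.mono (by omega)))
    have h' := this.trans h
    rw [Nat.cast_le] at h'
    omega
  · exact fun h => iInf₂_le n h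

/-! ### Forcing paths -/

/-- Let one player win within `n` moves, and let the opponent use a strategy that allows a loss only
in games through `v`: such a game passes through `v`, so the length of `v` is at most `n`. -/
lemma forcingLength_le_gameLength (r : Rule) (ω : Tree) :
    forcingLength r ω ≤ gameLength r ω := by
  refine iSup₂_le fun v hv => le_iInf₂ fun n ⟨a, h⟩ => ?_
  obtain ⟨s, ⟨m, hmn, he, hw⟩, h2⟩ := h.exists_and (hv.2 a.other)
  have hoo : a.other.other = a := by cases a <;> rfl
  rw [hoo] at h2
  obtain ⟨k, hk⟩ := h2.resolve_left fun h => h ⟨m, he, hw⟩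
  have : v.length ≤ m := by
    rw [← hk, ← he.1]
    rcases le_total k m with h | h
    · exact (play_prefix h).length_le
    · rw [he.play_eq h]
  exact_mod_cast this.trans hmn

/-- The path from the root to `v` stays in the tree, and no vertex that hangs off the path is lost
for the player to move there. -/
def IsForcedPath (r : Rule) : Tree → List ℕ → Prop
  | _, [] => True
  | ω, i :: v => i < ω [] ∧ (∀ j < ω [], j ≠ i → ¬ MoverLoses r (subtree ω [j])) ∧
      IsForcedPath r (subtree ω [i]) v

lemma IsForcedPath.of_prefix {v : List ℕ} (h : IsForcedPath r ω v) {u : List ℕ} {i : ℕ}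
    (hu : u ++ [i] <+: v) :
    i < ω u ∧ ∀ j < ω u, j ≠ i → ¬ MoverLoses r (subtree ω (u ++ [j])) := by
  induction u generalizing ω v with
  | nil =>
    obtain ⟨t, rfl⟩ := hu
    exact ⟨h.1, h.2.1⟩
  | cons k u ih =>
    obtain ⟨t, rfl⟩ := hu
    have := ih (ω := subtree ω [k]) h.2.2 ⟨t, rfl⟩
    simpa [subtree_subtree, subtree] using this

/-- A path is forcing if no vertex that hangs off the path is lost for the player to move there:
each player follows the path as long as possible, and plays safely once the opponent has left
it. -/
lemma IsForcedPath.isForcing {v : List ℕ} (h : IsForcedPath r ω v) : IsForcing r ω v := by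
  have hvert : IsVertex ω v := fun u i hu => (h.of_prefix hu).1
  refine ⟨hvert, fun a => ?_⟩
  -- A proper prefix of `v` is continued by a child that is still a prefix of `v`.
  have hnext : ∀ u, u <+: v → u ≠ v → ∃ i, u ++ [i] <+: v := by
    rintro u ⟨t, rfl⟩ hne
    cases t with
    | nil => simp at hne
    | cons i t => exact ⟨i, t, by simp⟩
  have hmov : ∀ {n : ℕ}, mover n = a → mover n ≠ a.other := fun h h' =>
    other_eq_iff.1 (h'.symm) h.symm
  have hmov' : ∀ {n : ℕ}, mover n ≠ a → mover n = a.other := fun h =>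
    (other_eq_iff.2 (Ne.symm h)).symm
  refine Guarantees.mono (guarantees_invariant
    (I := fun u => u <+: v ∨ v <+: u ∨ ¬ EventuallyWonFor r ω a.other u) (.inl (by simp)) ?_ ?_) ?_
  · rintro u (hu | hu | hu) hz hm
    · by_cases huv : u = v
      · exact ⟨0, Nat.pos_of_ne_zero hz, .inr (.inl (huv ▸ List.prefix_append _ _))⟩
      · obtain ⟨i, hi⟩ := hnext u hu huv
        exact ⟨i, hvert u i hi, .inl hi⟩
    · exact ⟨0, Nat.pos_of_ne_zero hz, .inr (.inl (hu.trans (List.prefix_append _ _)))⟩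
    · obtain ⟨i, hi, h⟩ := exists_child_not_eventuallyWonFor hu hz (hmov hm)
      exact ⟨i, hi, .inr (.inr h)⟩
  · rintro u (hu | hu | hu) hm j hj
    · by_cases huv : u = v
      · exact .inr (.inl (huv ▸ List.prefix_append _ _))
      · obtain ⟨i, hi⟩ := hnext u hu huv
        by_cases hij : j = i
        · exact .inl (hij ▸ hi)
        · refine .inr (.inr fun hc => (h.of_prefix hi).2 j hj hij (hc.2 ?_))
          rw [List.length_append, List.length_singleton, Ne, mover_succ_eq_iff, not_not]
          exact hmov' hm
    · exact .inr (.inl (hu.trans (List.prefix_append _ _)))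
    · exact .inr (.inr (child_not_eventuallyWonFor hu (hmov' hm) hj))
  · intro s hs
    by_cases hw : Wins r ω s a.other
    · right
      obtain ⟨m, he, hwin⟩ := hw
      rcases hs m with hu | hu | hu
      · refine ⟨m, ?_⟩
        by_contra hne
        obtain ⟨i, hi⟩ := hnext _ hu hne
        have := hvert _ _ hi
        rw [he.2] at this
        exact absurd this (Nat.not_lt_zero _)
      · refine ⟨v.length, ?_⟩
        have hle : v.length ≤ m := he.1 ▸ hu.length_le
        have hlen : (play ω s v.length).length = v.length := by
          rcases play_length_or (ω := ω) (s := s) v.length with h | ⟨k, hk, hek, h⟩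
          · exact h
          · have := hek.play_eq (n := m) (by omega)
            have h1 := he.1
            rw [this, hek.1] at h1
            omega
        exact List.IsPrefix.eq_of_length
          (List.prefix_of_prefix_length_le (play_prefix hle) hu hlen.le) hlen
      · exact absurd ((eventuallyWonFor_leaf he.2).2 (by rwa [he.1])) hu
    · exact .inl hw

mutual

/-- The player to move at the root of `ω` wins, and there is a path of length `n` from the root on
which the winning player has no other winning move; all other children of the vertices of the path
are won for the player to move there. -/
def ForcedWin (r : Rule) : ℕ → Tree → Prop
  | 0, ω => MoverWins r ω
  | n + 1, ω => ∃ i < ω [], ForcedLoss r n (subtree ω [i]) ∧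
      ∀ j < ω [], j ≠ i → MoverWins r (subtree ω [j])

/-- The player to move at the root of `ω` loses, and there is a path as in `ForcedWin`. -/
def ForcedLoss (r : Rule) : ℕ → Tree → Prop
  | 0, ω => MoverLoses r ω
  | n + 1, ω => (∀ j < ω [], MoverWins r (subtree ω [j])) ∧
      ∃ i < ω [], ForcedWin r n (subtree ω [i])

end

lemma forcedWin_forcedLoss_status (n : ℕ) : ∀ ω : Tree,
    (ForcedWin r n ω → MoverWins r ω) ∧ (ForcedLoss r n ω → MoverLoses r ω) := by
  induction n with
  | zero => intro ω; simp [ForcedWin, ForcedLoss]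
  | succ n ih =>
    refine fun ω => ⟨fun h => ?_, fun h => ?_⟩
    · rw [ForcedWin] at h
      obtain ⟨i, hi, h, -⟩ := h
      exact moverWins_iff.2 (.inr ⟨i, hi, (ih _).2 h⟩)
    · rw [ForcedLoss] at h
      obtain ⟨h, i, hi, -⟩ := h
      exact moverLoses_iff.2 ⟨fun h => by omega, h⟩

lemma exists_isForcedPath (n : ℕ) : ∀ ω : Tree, ForcedWin r n ω ∨ ForcedLoss r n ω →
    ∃ v, v.length = n ∧ IsForcedPath r ω v := by
  induction n with
  | zero => exact fun ω _ => ⟨[], rfl, trivial⟩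
  | succ n ih =>
    rintro ω (h | h)
    · rw [ForcedWin] at h
      obtain ⟨i, hi, h, hj⟩ := h
      obtain ⟨v, hv, hp⟩ := ih _ (.inr h)
      exact ⟨i :: v, by simp [hv], hi, fun j hj1 hj2 => (hj j hj1 hj2).not_moverLoses, hp⟩
    · rw [ForcedLoss] at h
      obtain ⟨hj, i, hi, h⟩ := h
      obtain ⟨v, hv, hp⟩ := ih _ (.inl h)
      exact ⟨i :: v, by simp [hv], hi, fun j hj1 _ => (hj j hj1).not_moverLoses, hp⟩

lemma ForcedWin.le_forcingLength {n : ℕ} (h : ForcedWin r n ω) : (n : ℕ∞) ≤ forcingLength r ω := by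
  obtain ⟨v, rfl, hp⟩ := exists_isForcedPath n ω (.inl h)
  exact le_iSup₂ (f := fun (v : List ℕ) (_ : IsForcing r ω v) => (v.length : ℕ∞)) v hp.isForcing

end TreeGame

namespace TreeGame

/-! ### Generating functions of sub-probability sequences -/

section powers

variable {x y : ℝ}

lemma pow_sub_pow_le (hy : 0 ≤ y) (hyx : y ≤ x) (k : ℕ) :
    x ^ k - y ^ k ≤ k * x ^ (k - 1) * (x - y) := by
  induction k with
  | zero => simp
  | succ k ih =>
    have h1 : y ^ k ≤ x ^ k := pow_le_pow_left₀ hy hyx k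
    have h2 : x * (k * x ^ (k - 1)) = k * x ^ k := by
      cases k with
      | zero => simp
      | succ k => simp; ring
    have h3 := mul_le_mul_of_nonneg_left ih (hy.trans hyx)
    have h4 := mul_le_mul_of_nonneg_right h1 (sub_nonneg.2 hyx)
    have h5 : x * (k * x ^ (k - 1) * (x - y)) = k * x ^ k * (x - y) := by rw [← h2]; ring
    rw [h5] at h3
    push_cast
    rw [pow_succ, pow_succ]
    nlinarith

lemma le_pow_sub_pow (hy : 0 ≤ y) (hyx : y ≤ x) (k : ℕ) :
    k * y ^ (k - 1) * (x - y) ≤ x ^ k - y ^ k := by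
  induction k with
  | zero => simp
  | succ k ih =>
    have h1 : y ^ k ≤ x ^ k := pow_le_pow_left₀ hy hyx k
    have h2 : y * (k * y ^ (k - 1)) = k * y ^ k := by
      cases k with
      | zero => simp
      | succ k => simp; ring
    have h3 := mul_le_mul_of_nonneg_left ih hy
    have h4 := mul_le_mul_of_nonneg_right h1 (sub_nonneg.2 hyx)
    have h5 : y * (k * y ^ (k - 1) * (x - y)) = k * y ^ k * (x - y) := by rw [← h2]; ring
    rw [h5] at h3
    push_cast
    rw [pow_succ, pow_succ]
    nlinarith

lemma mul_pow_pred_le (hy : 0 ≤ y) (hy1 : y < 1) (k : ℕ) : k * y ^ (k - 1) ≤ 1 / (1 - y) := by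
  rw [le_div_iff₀ (sub_pos.2 hy1)]
  have := le_pow_sub_pow hy hy1.le k
  have h2 := pow_nonneg hy k
  rw [one_pow] at this
  linarith

/-- One term of the binomial expansion of `(x + (1 - x)) ^ k`. -/
lemma mul_mul_pow_le (hx : 0 ≤ x) (hx1 : x < 1) (k : ℕ) :
    (k * (k - 1 : ℕ) : ℝ) * x ^ (k - 2) ≤ 2 / (1 - x) ^ 2 := by
  rw [le_div_iff₀ (by have := sub_pos.2 hx1; positivity)]
  rcases lt_or_ge k 2 with hk | hk
  · interval_cases k <;> simp
  · have h1x := sub_nonneg.2 hx1.le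
    have h := Finset.single_le_sum
      (f := fun m => (1 - x) ^ m * x ^ (k - m) * (k.choose m : ℝ))
      (fun m _ => by positivity) (Finset.mem_range.2 (show 2 < k + 1 by omega))
    rw [← add_pow, sub_add_cancel, one_pow] at h
    have hc : (k.choose 2 : ℝ) * 2 = k * (k - 1 : ℕ) := by
      rw [Nat.choose_two_right]
      exact_mod_cast Nat.div_mul_cancel (Nat.even_mul_pred_self k).two_dvd
    calc _ = 2 * ((1 - x) ^ 2 * x ^ (k - 2) * (k.choose 2 : ℝ)) := by rw [← hc]; ring
      _ ≤ 2 := by linarith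

lemma pow_sub_pow_ge (hy : 0 ≤ y) (hyx : y ≤ x) (hx1 : x < 1) (k : ℕ) :
    k * x ^ (k - 1) * (x - y) - 2 / (1 - x) ^ 2 * (x - y) ^ 2 ≤ x ^ k - y ^ k := by
  have h1 := le_pow_sub_pow hy hyx k
  have h2 := pow_sub_pow_le hy hyx (k - 1)
  have h3 := mul_mul_pow_le (hy.trans hyx) hx1 k
  have hxy := sub_nonneg.2 hyx
  have h4 := mul_le_mul_of_nonneg_right h3 (sq_nonneg (x - y))
  have h5 := mul_le_mul_of_nonneg_left h2 (show (0 : ℝ) ≤ k * (x - y) by positivity)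
  rw [Nat.sub_sub] at h5
  nlinarith

end powers

/-- A sequence of nonnegative numbers whose sum is at most one. -/
structure IsSubProb (g : ℕ → ℝ) : Prop where
  nonneg : ∀ k, 0 ≤ g k
  summable : Summable g
  tsum_le_one : ∑' k, g k ≤ 1

/-- The generating function of a sequence. -/
noncomputable def gen (g : ℕ → ℝ) (y : ℝ) : ℝ := ∑' k, g k * y ^ k

/-- The derivative of the generating function of a sequence, as a power series. -/
noncomputable def genDeriv (g : ℕ → ℝ) (y : ℝ) : ℝ := ∑' k : ℕ, g k * (k * y ^ (k - 1))

namespace IsSubProb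

variable {g h : ℕ → ℝ} {x y : ℝ}

lemma summable_mul (hg : IsSubProb g) {f : ℕ → ℝ} {C : ℝ} (h0 : ∀ k, 0 ≤ f k)
    (hC : ∀ k, f k ≤ C) : Summable fun k => g k * f k :=
  Summable.of_nonneg_of_le (fun k => mul_nonneg (hg.nonneg k) (h0 k))
    (fun k => mul_le_mul_of_nonneg_left (hC k) (hg.nonneg k)) (hg.summable.mul_right C)

lemma summable_gen (hg : IsSubProb g) (hy : 0 ≤ y) (hy1 : y ≤ 1) :
    Summable fun k => g k * y ^ k :=
  hg.summable_mul (fun k => pow_nonneg hy k) fun _ => pow_le_one₀ hy hy1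

lemma summable_genDeriv (hg : IsSubProb g) (hy : 0 ≤ y) (hy1 : y < 1) :
    Summable fun k : ℕ => g k * (k * y ^ (k - 1)) :=
  hg.summable_mul (fun k => by positivity) (mul_pow_pred_le hy hy1)

lemma gen_mono (hg : IsSubProb g) (hy : 0 ≤ y) (hyx : y ≤ x) (hx1 : x ≤ 1) :
    gen g y ≤ gen g x :=
  (hg.summable_gen hy (hyx.trans hx1)).tsum_le_tsum
    (fun k => mul_le_mul_of_nonneg_left (pow_le_pow_left₀ hy hyx k) (hg.nonneg k))
    (hg.summable_gen (hy.trans hyx) hx1)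

lemma gen_one (g : ℕ → ℝ) : gen g 1 = ∑' k, g k := by simp [gen]

lemma gen_le_one (hg : IsSubProb g) (hy : 0 ≤ y) (hy1 : y ≤ 1) : gen g y ≤ 1 :=
  (hg.gen_mono hy hy1 le_rfl).trans (gen_one g ▸ hg.tsum_le_one)

lemma gen_lt (hg : IsSubProb g) (hy : 0 ≤ y) (hyx : y < x) (hx1 : x ≤ 1) {k : ℕ} (hk : k ≠ 0)
    (hgk : 0 < g k) : gen g y < gen g x :=
  Summable.tsum_lt_tsum (i := k)
    (fun j => mul_le_mul_of_nonneg_left (pow_le_pow_left₀ hy hyx.le j) (hg.nonneg j))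
    (mul_lt_mul_of_pos_left (pow_lt_pow_left₀ hyx hy hk) hgk)
    (hg.summable_gen hy (hyx.le.trans hx1)) (hg.summable_gen (hy.trans hyx.le) hx1)

lemma exists_pos_of_genDeriv_pos (hg : IsSubProb g) (h : 0 < genDeriv g y) :
    ∃ k ≠ 0, 0 < g k := by
  by_contra! hc
  have : genDeriv g y = 0 := by
    refine (tsum_congr fun k => ?_).trans tsum_zero
    rcases eq_or_ne k 0 with rfl | hk
    · simp
    · rw [le_antisymm (hc k hk) (hg.nonneg k), zero_mul]
  exact h.ne' this

lemma gen_sub (hg : IsSubProb g) (hy : 0 ≤ y) (hyx : y ≤ x) (hx1 : x ≤ 1) :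
    gen g x - gen g y = ∑' k, g k * (x ^ k - y ^ k) := by
  simp only [mul_sub]
  exact ((hg.summable_gen (hy.trans hyx) hx1).tsum_sub
    (hg.summable_gen hy (hyx.trans hx1))).symm

lemma summable_gen_sub (hg : IsSubProb g) (hy : 0 ≤ y) (hyx : y ≤ x) (hx1 : x ≤ 1) :
    Summable fun k => g k * (x ^ k - y ^ k) := by
  simp only [mul_sub]
  exact (hg.summable_gen (hy.trans hyx) hx1).sub (hg.summable_gen hy (hyx.trans hx1))

lemma gen_sub_le (hg : IsSubProb g) (hy : 0 ≤ y) (hyx : y ≤ x) (hx1 : x < 1) :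
    gen g x - gen g y ≤ genDeriv g x * (x - y) := by
  rw [hg.gen_sub hy hyx hx1.le, genDeriv, ← tsum_mul_right]
  refine (hg.summable_gen_sub hy hyx hx1.le).tsum_le_tsum (fun k => ?_)
    ((hg.summable_genDeriv (hy.trans hyx) hx1).mul_right _)
  rw [mul_assoc]
  exact mul_le_mul_of_nonneg_left (pow_sub_pow_le hy hyx k) (hg.nonneg k)

lemma le_gen_sub (hg : IsSubProb g) (hy : 0 ≤ y) (hyx : y ≤ x) (hy1 : y < 1) (hx1 : x ≤ 1) :
    genDeriv g y * (x - y) ≤ gen g x - gen g y := by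
  rw [hg.gen_sub hy hyx hx1, genDeriv, ← tsum_mul_right]
  refine ((hg.summable_genDeriv hy hy1).mul_right _).tsum_le_tsum (fun k => ?_)
    (hg.summable_gen_sub hy hyx hx1)
  rw [mul_assoc]
  exact mul_le_mul_of_nonneg_left (le_pow_sub_pow hy hyx k) (hg.nonneg k)

lemma gen_sub_ge (hg : IsSubProb g) (hy : 0 ≤ y) (hyx : y ≤ x) (hx1 : x < 1) :
    genDeriv g x * (x - y) - 2 / (1 - x) ^ 2 * (x - y) ^ 2 ≤ gen g x - gen g y := by
  rw [hg.gen_sub hy hyx hx1.le, genDeriv, ← tsum_mul_right]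
  set C := 2 / (1 - x) ^ 2 * (x - y) ^ 2 with hC
  have hC0 : 0 ≤ C := by positivity
  have hs1 : Summable fun k : ℕ => g k * (k * x ^ (k - 1)) * (x - y) :=
    (hg.summable_genDeriv (hy.trans hyx) hx1).mul_right _
  have hs2 : Summable fun k => g k * C := hg.summable.mul_right _
  have h1 : ∑' k, g k * C ≤ C := by
    rw [tsum_mul_right]; exact mul_le_of_le_one_left hC0 hg.tsum_le_one
  have h2 : ∑' k : ℕ, (g k * (k * x ^ (k - 1)) * (x - y) - g k * C) ≤
      ∑' k, g k * (x ^ k - y ^ k) := by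
    refine (hs1.sub hs2).tsum_le_tsum (fun k => ?_) (hg.summable_gen_sub hy hyx hx1.le)
    rw [mul_assoc, ← mul_sub]
    exact mul_le_mul_of_nonneg_left (pow_sub_pow_ge hy hyx hx1 k) (hg.nonneg k)
  rw [hs1.tsum_sub hs2] at h2
  linarith

lemma genDeriv_mono (hg : IsSubProb g) (hy : 0 ≤ y) (hyx : y ≤ x) (hx1 : x < 1) :
    genDeriv g y ≤ genDeriv g x :=
  (hg.summable_genDeriv hy (hyx.trans_lt hx1)).tsum_le_tsum
    (fun k => mul_le_mul_of_nonneg_left (mul_le_mul_of_nonneg_left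
      (pow_le_pow_left₀ hy hyx _) (Nat.cast_nonneg k)) (hg.nonneg k))
    (hg.summable_genDeriv (hy.trans hyx) hx1)

lemma continuousOn_gen (hg : IsSubProb g) : ContinuousOn (gen g) (Set.Icc 0 1) := by
  refine continuousOn_tsum (u := g) (fun k => by fun_prop) hg.summable fun k y hy => ?_
  rw [Real.norm_of_nonneg (mul_nonneg (hg.nonneg k) (pow_nonneg hy.1 k))]
  exact mul_le_of_le_one_right (hg.nonneg k) (pow_le_one₀ hy.1 hy.2)

lemma continuousOn_genDeriv (hg : IsSubProb g) (hx1 : x < 1) :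
    ContinuousOn (genDeriv g) (Set.Icc 0 x) := by
  refine continuousOn_tsum (u := fun k => g k * (1 / (1 - x))) (fun k => by fun_prop)
    (hg.summable.mul_right _) fun k y hy => ?_
  rw [Real.norm_of_nonneg (mul_nonneg (hg.nonneg k)
    (mul_nonneg k.cast_nonneg (pow_nonneg hy.1 _)))]
  refine mul_le_mul_of_nonneg_left ?_ (hg.nonneg k)
  exact (mul_le_mul_of_nonneg_left (pow_le_pow_left₀ hy.1 hy.2 _) k.cast_nonneg).trans
    (mul_pow_pred_le (hy.1.trans hy.2) hx1 k)

end IsSubProb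

lemma abs_tsum_mul_sub_le {g h f d : ℕ → ℝ} {C : ℝ} (hf0 : ∀ k, 0 ≤ f k) (hfC : ∀ k, f k ≤ C)
    (hg : Summable fun k => g k * f k) (hh : Summable fun k => h k * f k)
    (hd : ∀ k, |h k - g k| ≤ d k) (hds : Summable d) :
    |∑' k, h k * f k - ∑' k, g k * f k| ≤ (∑' k, d k) * C := by
  rw [← hh.tsum_sub hg, ← tsum_mul_right]
  have hle : ∀ k, |h k * f k - g k * f k| ≤ d k * C := fun k => by
    rw [← sub_mul, abs_mul, abs_of_nonneg (hf0 k)]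
    exact mul_le_mul (hd k) (hfC k) (hf0 k) ((abs_nonneg _).trans (hd k))
  have hs : Summable fun k => |h k * f k - g k * f k| :=
    Summable.of_nonneg_of_le (fun k => abs_nonneg _) hle (hds.mul_right C)
  exact (norm_tsum_le_tsum_norm (f := fun k => h k * f k - g k * f k) hs).trans
    (hs.tsum_le_tsum hle (hds.mul_right C))

/-! ### The weights of an offspring distribution -/

open Classical in
/-- The offspring distribution `p` as a sequence of real numbers, with the weight of a leaf set to
zero in the misère game, where a leaf is not lost for the player to move. -/
noncomputable def weight (r : Rule) (p : PMF ℕ) (k : ℕ) : ℝ :=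
  if r = .misere ∧ k = 0 then 0 else (p k).toReal

variable {r : Rule} {p q : PMF ℕ}

lemma weight_le (k : ℕ) : weight r p k ≤ (p k).toReal := by
  unfold weight; split_ifs <;> simp

lemma weight_of_ne_zero {k : ℕ} (hk : k ≠ 0) : weight r p k = (p k).toReal := by
  simp [weight, hk]

lemma tsum_toReal (p : PMF ℕ) : ∑' k, (p k).toReal = 1 := by
  rw [← ENNReal.tsum_toReal_eq p.apply_ne_top, p.tsum_coe, ENNReal.toReal_one]

lemma isSubProb_weight (r : Rule) (p : PMF ℕ) : IsSubProb (weight r p) := by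
  have h0 : ∀ k, 0 ≤ weight r p k := fun k => by unfold weight; split_ifs <;> simp
  have hs : Summable (weight r p) := .of_nonneg_of_le h0 weight_le (offspring_summable p)
  exact ⟨h0, hs, (hs.tsum_le_tsum weight_le (offspring_summable p)).trans (tsum_toReal p).le⟩

lemma abs_weight_sub_le (k : ℕ) :
    |weight r q k - weight r p k| ≤ |(q k).toReal - (p k).toReal| := by
  unfold weight; split_ifs <;> simp

lemma abs_gen_sub_le {y : ℝ} (hy : 0 ≤ y) (hy1 : y ≤ 1) :
    |gen (weight r q) y - gen (weight r p) y| ≤ dist q p := by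
  have := abs_tsum_mul_sub_le (fun k => pow_nonneg hy k) (fun k => pow_le_one₀ hy hy1)
    ((isSubProb_weight r p).summable_gen hy hy1) ((isSubProb_weight r q).summable_gen hy hy1)
    abs_weight_sub_le (offspring_summable_diff q p)
  rwa [mul_one] at this

lemma abs_genDeriv_sub_le {y : ℝ} (hy : 0 ≤ y) (hy1 : y < 1) :
    |genDeriv (weight r q) y - genDeriv (weight r p) y| ≤ dist q p * (1 / (1 - y)) :=
  abs_tsum_mul_sub_le (fun k => by positivity) (mul_pow_pred_le hy hy1)
    ((isSubProb_weight r p).summable_genDeriv hy hy1)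
    ((isSubProb_weight r q).summable_genDeriv hy hy1)
    abs_weight_sub_le (offspring_summable_diff q p)

section tendsto

variable {ι : Type*} {l : Filter ι} {f : ι → PMF ℕ} {y : ι → ℝ} {y₀ : ℝ}

lemma tendsto_gen (hf : Tendsto f l (𝓝 p)) (hy : Tendsto y l (𝓝 y₀))
    (hy01 : ∀ i, y i ∈ Set.Icc (0 : ℝ) 1) (hy₀ : y₀ ∈ Set.Icc (0 : ℝ) 1) :
    Tendsto (fun i => gen (weight r (f i)) (y i)) l (𝓝 (gen (weight r p) y₀)) := by
  have h1 : Tendsto (fun i => gen (weight r p) (y i)) l (𝓝 (gen (weight r p) y₀)) :=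
    ((isSubProb_weight r p).continuousOn_gen y₀ hy₀).tendsto.comp
      (tendsto_nhdsWithin_iff.2 ⟨hy, .of_forall hy01⟩)
  have h2 : Tendsto (fun i => gen (weight r (f i)) (y i) - gen (weight r p) (y i)) l (𝓝 0) :=
    squeeze_zero_norm (fun i => abs_gen_sub_le (hy01 i).1 (hy01 i).2)
      (tendsto_iff_dist_tendsto_zero.1 hf)
  simpa using h2.add h1

lemma tendsto_genDeriv (hf : Tendsto f l (𝓝 p)) (hy : Tendsto y l (𝓝 y₀))
    (hy0 : ∀ i, 0 ≤ y i) (hy₀ : 0 ≤ y₀) (hy₁ : y₀ < 1) :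
    Tendsto (fun i => genDeriv (weight r (f i)) (y i)) l (𝓝 (genDeriv (weight r p) y₀)) := by
  obtain ⟨x, hx, hx1⟩ := exists_between hy₁
  have hev : ∀ᶠ i in l, y i ≤ x := (hy.eventually_lt_const hx).mono fun i h => h.le
  have h1 : Tendsto (fun i => genDeriv (weight r p) (y i)) l
      (𝓝 (genDeriv (weight r p) y₀)) :=
    ((isSubProb_weight r p).continuousOn_genDeriv hx1 y₀ ⟨hy₀, hx.le⟩).tendsto.comp
      (tendsto_nhdsWithin_iff.2 ⟨hy, hev.mono fun i hi => ⟨hy0 i, hi⟩⟩)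
  have h2 : Tendsto (fun i => genDeriv (weight r (f i)) (y i) - genDeriv (weight r p) (y i)) l
      (𝓝 0) := by
    have hd : Tendsto (fun i => dist (f i) p * (1 / (1 - x))) l (𝓝 0) := by
      simpa using (tendsto_iff_dist_tendsto_zero.1 hf).mul_const (1 / (1 - x))
    refine squeeze_zero_norm' (hev.mono fun i hi => ?_) hd
    refine (abs_genDeriv_sub_le (hy0 i) (hi.trans_lt hx1)).trans ?_
    have := sub_pos.2 hx1
    gcongr
  simpa using h2.add h1

end tendsto

end TreeGame

namespace TreeGame

/-! ### Probabilities of winning and losing -/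

/-- The probability that the player to move can force a win in fewer than `n` moves. -/
noncomputable def winProbIn (r : Rule) (p : PMF ℕ) (n : ℕ) : ℝ :=
  (treeLaw p).real {ω | WinsIn r n ω}

/-- The probability that the opponent of the player to move cannot force a win in fewer than `n`
moves. -/
noncomputable def notLoseProbIn (r : Rule) (p : PMF ℕ) (n : ℕ) : ℝ :=
  1 - (treeLaw p).real {ω | LosesIn r n ω}

/-- The probability that the player to move can force a win. -/
noncomputable def winProb (r : Rule) (p : PMF ℕ) : ℝ :=
  (treeLaw p).real {ω | MoverWins r ω}

/-- The probability that the opponent of the player to move cannot force a win. -/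
noncomputable def notLoseProb (r : Rule) (p : PMF ℕ) : ℝ :=
  1 - (treeLaw p).real {ω | MoverLoses r ω}

variable {r : Rule} {p : PMF ℕ}

/-- The trees that are lost for the player to move if exactly the trees in `A` are won. -/
def allChildrenIn (r : Rule) (A : Set Tree) : Set Tree :=
  {ω | ω [] ∈ {k : ℕ | ¬ (r = .misere ∧ k = 0)} ∧ ∀ i < ω [], subtree ω [i] ∈ A}

lemma measurableSet_allChildrenIn {A : Set Tree} (hA : MeasurableSet A) :
    MeasurableSet (allChildrenIn r A) :=
  (measurableSet_rootDegree {k : ℕ | ¬ (r = .misere ∧ k = 0)}).inter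
    (measurableSet_forall_subtree hA)

lemma measureReal_allChildrenIn {A : Set Tree} (hA : MeasurableSet A) :
    (treeLaw p).real (allChildrenIn r A) = gen (weight r p) ((treeLaw p).real A) := by
  classical
  rw [allChildrenIn, measureReal_forall_subtree p _ hA, gen]
  refine tsum_congr fun k => ?_
  by_cases hk : r = .misere ∧ k = 0 <;> simp [weight, hk]

lemma setOf_losesIn_succ (n : ℕ) :
    {ω | LosesIn r (n + 1) ω} = allChildrenIn r {ω | WinsIn r n ω} := by
  ext ω; simp [LosesIn, allChildrenIn]

lemma compl_setOf_winsIn_succ (n : ℕ) :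
    {ω | WinsIn r (n + 1) ω}ᶜ = allChildrenIn r {ω | LosesIn r n ω}ᶜ := by
  ext ω; simp [WinsIn, allChildrenIn]

lemma setOf_moverLoses : {ω | MoverLoses r ω} = allChildrenIn r {ω | MoverWins r ω} := by
  ext ω
  rw [Set.mem_ofPred_eq, moverLoses_iff]
  simp [allChildrenIn]

lemma compl_setOf_moverWins :
    {ω | MoverWins r ω}ᶜ = allChildrenIn r {ω | MoverLoses r ω}ᶜ := by
  ext ω
  rw [Set.mem_compl_iff, Set.mem_ofPred_eq, moverWins_iff]
  simp [allChildrenIn]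

lemma measurableSet_winsIn_and_losesIn (n : ℕ) :
    MeasurableSet {ω | WinsIn r n ω} ∧ MeasurableSet {ω | LosesIn r n ω} := by
  induction n with
  | zero => simp
  | succ n ih =>
    refine ⟨?_, ?_⟩
    · rw [← MeasurableSet.compl_iff, compl_setOf_winsIn_succ]
      exact measurableSet_allChildrenIn ih.2.compl
    · rw [setOf_losesIn_succ]
      exact measurableSet_allChildrenIn ih.1

lemma setOf_moverWins_eq : {ω | MoverWins r ω} = ⋃ n, {ω | WinsIn r n ω} := by
  ext ω; simp [MoverWins]

lemma setOf_moverLoses_eq : {ω | MoverLoses r ω} = ⋃ n, {ω | LosesIn r n ω} := by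
  ext ω; simp [MoverLoses]

lemma measurableSet_moverWins : MeasurableSet {ω | MoverWins r ω} :=
  setOf_moverWins_eq (r := r) ▸ .iUnion fun n => (measurableSet_winsIn_and_losesIn n).1

lemma measurableSet_moverLoses : MeasurableSet {ω | MoverLoses r ω} :=
  setOf_moverLoses_eq (r := r) ▸ .iUnion fun n => (measurableSet_winsIn_and_losesIn n).2

@[simp] lemma winProbIn_zero : winProbIn r p 0 = 0 := by simp [winProbIn]

@[simp] lemma notLoseProbIn_zero : notLoseProbIn r p 0 = 1 := by simp [notLoseProbIn]

lemma winProbIn_succ (n : ℕ) :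
    winProbIn r p (n + 1) = 1 - gen (weight r p) (notLoseProbIn r p n) := by
  have hm := (measurableSet_winsIn_and_losesIn (r := r) n).2
  rw [notLoseProbIn, ← probReal_compl_eq_one_sub hm, ← measureReal_allChildrenIn hm.compl,
    ← compl_setOf_winsIn_succ,
    probReal_compl_eq_one_sub (measurableSet_winsIn_and_losesIn (n + 1)).1, sub_sub_cancel,
    winProbIn]

lemma notLoseProbIn_succ (n : ℕ) :
    notLoseProbIn r p (n + 1) = 1 - gen (weight r p) (winProbIn r p n) := by
  rw [winProbIn, ← measureReal_allChildrenIn (measurableSet_winsIn_and_losesIn n).1,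
    ← setOf_losesIn_succ, notLoseProbIn]

lemma winProb_eq : winProb r p = 1 - gen (weight r p) (notLoseProb r p) := by
  have hm := measurableSet_moverLoses (r := r)
  rw [notLoseProb, ← probReal_compl_eq_one_sub hm, ← measureReal_allChildrenIn hm.compl,
    ← compl_setOf_moverWins, probReal_compl_eq_one_sub measurableSet_moverWins, sub_sub_cancel,
    winProb]

lemma notLoseProb_eq : notLoseProb r p = 1 - gen (weight r p) (winProb r p) := by
  rw [winProb, ← measureReal_allChildrenIn measurableSet_moverWins, ← setOf_moverLoses,
    notLoseProb]

lemma notLoseProbIn_anti : Antitone (notLoseProbIn r p) := fun _ _ h =>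
  sub_le_sub_left (measureReal_mono fun _ => LosesIn.mono h) 1

lemma winProbIn_le (n : ℕ) : winProbIn r p n ≤ winProb r p :=
  measureReal_mono fun ω (h : WinsIn r n ω) => (⟨n, h⟩ : MoverWins r ω)

lemma le_notLoseProbIn (n : ℕ) : notLoseProb r p ≤ notLoseProbIn r p n :=
  sub_le_sub_left (measureReal_mono fun ω (h : LosesIn r n ω) => (⟨n, h⟩ : MoverLoses r ω)) 1

lemma tendsto_winProbIn : Tendsto (winProbIn r p) atTop (𝓝 (winProb r p)) := by
  have h := tendsto_measure_iUnion_atTop (μ := treeLaw p) (s := fun n => {ω | WinsIn r n ω})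
    fun _ _ h _ => WinsIn.mono h
  rw [← setOf_moverWins_eq] at h
  exact (ENNReal.tendsto_toReal (measure_ne_top _ _)).comp h

lemma tendsto_notLoseProbIn : Tendsto (notLoseProbIn r p) atTop (𝓝 (notLoseProb r p)) := by
  have h := tendsto_measure_iUnion_atTop (μ := treeLaw p) (s := fun n => {ω | LosesIn r n ω})
    fun _ _ h _ => LosesIn.mono h
  rw [← setOf_moverLoses_eq] at h
  exact ((ENNReal.tendsto_toReal (measure_ne_top _ _)).comp h).const_sub 1

lemma winProbIn_mem (n : ℕ) : winProbIn r p n ∈ Set.Icc (0 : ℝ) 1 :=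
  ⟨measureReal_nonneg, measureReal_le_one⟩

lemma notLoseProbIn_mem (n : ℕ) : notLoseProbIn r p n ∈ Set.Icc (0 : ℝ) 1 :=
  ⟨sub_nonneg.2 measureReal_le_one, sub_le_self _ measureReal_nonneg⟩

lemma winProb_mem : winProb r p ∈ Set.Icc (0 : ℝ) 1 :=
  ⟨measureReal_nonneg, measureReal_le_one⟩

lemma notLoseProb_mem : notLoseProb r p ∈ Set.Icc (0 : ℝ) 1 :=
  ⟨sub_nonneg.2 measureReal_le_one, sub_le_self _ measureReal_nonneg⟩

lemma measureReal_not_and_not {A B : Set Tree} (hA : MeasurableSet A) (hB : MeasurableSet B)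
    (hAB : Disjoint A B) :
    (treeLaw p).real (Aᶜ ∩ Bᶜ) = 1 - (treeLaw p).real B - (treeLaw p).real A := by
  rw [← Set.compl_union, probReal_compl_eq_one_sub (hA.union hB), measureReal_union hAB hB]
  ring

/-- The probability that no player can force a win in fewer than `n` moves. -/
lemma measureReal_undecided (n : ℕ) :
    (treeLaw p).real {ω | ¬ WinsIn r n ω ∧ ¬ LosesIn r n ω} =
      notLoseProbIn r p n - winProbIn r p n :=
  measureReal_not_and_not (measurableSet_winsIn_and_losesIn n).1
    (measurableSet_winsIn_and_losesIn n).2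
    (Set.disjoint_left.2 fun ω h1 h2 => not_winsIn_and_losesIn n ω ⟨h1, h2⟩)

lemma drawProb_eq : drawProb r p = ENNReal.ofReal (notLoseProb r p - winProb r p) := by
  have h := measureReal_not_and_not (p := p) (measurableSet_moverWins (r := r))
    measurableSet_moverLoses
    (Set.disjoint_left.2 fun ω (h1 : MoverWins r ω) h2 => h1.not_moverLoses h2)
  rw [notLoseProb, winProb, ← h, ofReal_measureReal, drawProb]
  congr 1
  ext ω
  simp [isDraw_iff]

lemma winProb_le_notLoseProb : winProb r p ≤ notLoseProb r p := by
  have h : ∀ n, winProbIn r p n ≤ notLoseProbIn r p n := fun n => by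
    rw [← sub_nonneg, ← measureReal_undecided]; exact measureReal_nonneg
  exact le_of_tendsto_of_tendsto' tendsto_winProbIn tendsto_notLoseProbIn h

lemma mem_drawFree_iff : p ∈ drawFree r ↔ notLoseProb r p = winProb r p := by
  rw [drawFree, Set.mem_ofPred_eq, drawProb_eq, ENNReal.ofReal_eq_zero, sub_nonpos]
  exact ⟨fun h => h.antisymm winProb_le_notLoseProb, fun h => h.le⟩

lemma enat_eq_tsum (t : ℕ∞) : (t : ℝ≥0∞) = ∑' n : ℕ, if (n : ℕ∞) < t then 1 else 0 := by
  induction t with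
  | top => simp
  | coe m =>
    rw [tsum_eq_sum (s := Finset.range m) fun n hn => by simpa using hn]
    rw [Finset.sum_congr rfl (g := fun _ => 1) fun n hn => by simpa using hn]
    simp

/-- The expected length of the game is the sum of the probabilities that the game is not yet
decided. -/
lemma meanGameLength_eq : meanGameLength r p =
    ∑' n, ENNReal.ofReal (notLoseProbIn r p (n + 1) - winProbIn r p (n + 1)) := by
  classical
  have hm : ∀ n, MeasurableSet {ω | ¬ WinsIn r n ω ∧ ¬ LosesIn r n ω} := fun n =>
    (measurableSet_winsIn_and_losesIn n).1.compl.inter (measurableSet_winsIn_and_losesIn n).2.compl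
  have h : ∀ ω, (gameLength r ω : ℝ≥0∞) =
      ∑' n, {ω | ¬ WinsIn r (n + 1) ω ∧ ¬ LosesIn r (n + 1) ω}.indicator 1 ω := fun ω => by
    simp only [enat_eq_tsum, lt_gameLength_iff, Set.indicator, Set.mem_ofPred_eq, Pi.one_apply]
  simp only [meanGameLength, h]
  rw [lintegral_tsum fun n => (measurable_one.indicator (hm _)).aemeasurable]
  refine tsum_congr fun n => ?_
  rw [lintegral_indicator_one (hm _), ← measureReal_undecided, ofReal_measureReal]

/-! ### Probabilities of forced paths -/

/-- The probability that the player to move wins along a forced path of length `n`. -/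
noncomputable def forcedWinProb (r : Rule) (p : PMF ℕ) (n : ℕ) : ℝ :=
  (treeLaw p).real {ω | ForcedWin r n ω}

/-- The probability that the player to move loses along a forced path of length `n`. -/
noncomputable def forcedLossProb (r : Rule) (p : PMF ℕ) (n : ℕ) : ℝ :=
  (treeLaw p).real {ω | ForcedLoss r n ω}

lemma setOf_forcedWin_succ (n : ℕ) : {ω | ForcedWin r (n + 1) ω} =
    {ω | ∃ i < ω [], subtree ω [i] ∈ {ω | ForcedLoss r n ω} ∧
      ∀ j < ω [], j ≠ i → subtree ω [j] ∈ {ω | MoverWins r ω}} := by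
  ext ω; simp [ForcedWin]

lemma setOf_forcedLoss_succ (n : ℕ) : {ω | ForcedLoss r (n + 1) ω} =
    allChildrenIn r {ω | MoverWins r ω} \
      allChildrenIn r ({ω | MoverWins r ω} \ {ω | ForcedWin r n ω}) := by
  ext ω
  simp only [ForcedLoss, allChildrenIn, Set.mem_sdiff, Set.mem_ofPred_eq]
  constructor
  · rintro ⟨h, i, hi, hf⟩
    exact ⟨⟨fun h => by omega, h⟩, fun hc => (hc.2 i hi).2 hf⟩
  · rintro ⟨⟨h0, h⟩, hc⟩
    refine ⟨h, ?_⟩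
    by_contra! hcon
    exact hc ⟨h0, fun i hi => ⟨h i hi, hcon i hi⟩⟩

lemma measurableSet_forcedWin_and_forcedLoss (n : ℕ) :
    MeasurableSet {ω | ForcedWin r n ω} ∧ MeasurableSet {ω | ForcedLoss r n ω} := by
  induction n with
  | zero =>
    simp only [ForcedWin, ForcedLoss]
    exact ⟨measurableSet_moverWins, measurableSet_moverLoses⟩
  | succ n ih =>
    rw [setOf_forcedWin_succ, setOf_forcedLoss_succ]
    exact ⟨measurableSet_exists_unique_subtree ih.2 measurableSet_moverWins,
      (measurableSet_allChildrenIn measurableSet_moverWins).diff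
        (measurableSet_allChildrenIn (measurableSet_moverWins.diff ih.1))⟩

lemma forcedWinProb_zero : forcedWinProb r p 0 = winProb r p := by
  simp only [forcedWinProb, ForcedWin, winProb]

lemma forcedLossProb_zero : forcedLossProb r p 0 = 1 - notLoseProb r p := by
  simp only [forcedLossProb, ForcedLoss, notLoseProb, sub_sub_cancel]

lemma forcedWinProb_nonneg (n : ℕ) : 0 ≤ forcedWinProb r p n := measureReal_nonneg

lemma forcedWinProb_le (n : ℕ) : forcedWinProb r p n ≤ winProb r p :=
  measureReal_mono fun ω h => (forcedWin_forcedLoss_status n ω).1 h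

lemma forcedWinProb_succ (n : ℕ) : forcedWinProb r p (n + 1) =
    genDeriv (weight r p) (winProb r p) * forcedLossProb r p n := by
  have hd : Disjoint {ω | ForcedLoss r n ω} {ω | MoverWins r ω} :=
    Set.disjoint_left.2 fun ω h1 (h2 : MoverWins r ω) =>
      h2.not_moverLoses ((forcedWin_forcedLoss_status n ω).2 h1)
  rw [forcedWinProb, setOf_forcedWin_succ, measureReal_exists_unique_subtree p
    (measurableSet_forcedWin_and_forcedLoss n).2 measurableSet_moverWins hd, genDeriv,
    ← tsum_mul_right]
  refine tsum_congr fun k => ?_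
  rcases eq_or_ne k 0 with rfl | hk
  · simp
  · rw [weight_of_ne_zero hk, forcedLossProb, winProb]
    ring

lemma forcedLossProb_succ (n : ℕ) : forcedLossProb r p (n + 1) =
    gen (weight r p) (winProb r p) -
      gen (weight r p) (winProb r p - forcedWinProb r p n) := by
  have hW := measurableSet_moverWins (r := r)
  have hF := (measurableSet_forcedWin_and_forcedLoss (r := r) n).1
  have hsub : {ω | ForcedWin r n ω} ⊆ {ω | MoverWins r ω} :=
    fun ω h => (forcedWin_forcedLoss_status n ω).1 h
  rw [forcedLossProb, setOf_forcedLoss_succ, measureReal_sdiff _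
    (measurableSet_allChildrenIn (hW.diff hF)), measureReal_allChildrenIn hW,
    measureReal_allChildrenIn (hW.diff hF), measureReal_sdiff hsub hF]
  · rfl
  · exact fun ω h => ⟨h.1, fun i hi => (h.2 i hi).1⟩

lemma tsum_forcedWinProb_le :
    ∑' n, ENNReal.ofReal (forcedWinProb r p (n + 1)) ≤ meanForcingLength r p := by
  classical
  have hm := fun n => (measurableSet_forcedWin_and_forcedLoss (r := r) n).1
  have h : ∀ ω, ∑' n, {ω | ForcedWin r (n + 1) ω}.indicator 1 ω ≤
      (forcingLength r ω : ℝ≥0∞) := fun ω => by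
    rw [enat_eq_tsum]
    refine ENNReal.tsum_le_tsum fun n => ?_
    by_cases hn : ForcedWin r (n + 1) ω
    · have : (n : ℕ∞) < forcingLength r ω :=
        lt_of_lt_of_le (by exact_mod_cast n.lt_succ_self) hn.le_forcingLength
      simp [this, Set.indicator_apply_le']
    · simp [hn]
  refine le_trans (le_of_eq ?_) (lintegral_mono h)
  rw [lintegral_tsum fun n => (measurable_one.indicator (hm _)).aemeasurable]
  refine tsum_congr fun n => ?_
  rw [lintegral_indicator_one (hm _), forcedWinProb, ofReal_measureReal]

lemma meanForcingLength_le_meanGameLength : meanForcingLength r p ≤ meanGameLength r p :=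
  lintegral_mono fun ω => ENat.toENNReal_le.2 (forcingLength_le_gameLength r ω)

end TreeGame

namespace TreeGame

variable {r : Rule} {p q : PMF ℕ} {x : ℝ}

/-! ### Continuity in the offspring distribution -/

section tendsto

variable {ι : Type*} {l : Filter ι} {f : ι → PMF ℕ}

lemma tendsto_winProbIn_and_notLoseProbIn (hf : Tendsto f l (𝓝 p)) (n : ℕ) :
    Tendsto (fun i => winProbIn r (f i) n) l (𝓝 (winProbIn r p n)) ∧
      Tendsto (fun i => notLoseProbIn r (f i) n) l (𝓝 (notLoseProbIn r p n)) := by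
  induction n with
  | zero => simp [tendsto_const_nhds]
  | succ n ih =>
    simp only [winProbIn_succ, notLoseProbIn_succ]
    exact ⟨(tendsto_gen hf ih.2 (fun _ => notLoseProbIn_mem n) (notLoseProbIn_mem n)).const_sub 1,
      (tendsto_gen hf ih.1 (fun _ => winProbIn_mem n) (winProbIn_mem n)).const_sub 1⟩

lemma one_sub_gen_winProb (hp : p ∈ drawFree r) :
    1 - gen (weight r p) (winProb r p) = winProb r p := by
  rw [← notLoseProb_eq, mem_drawFree_iff.1 hp]

/-- Since `1 - gen` is decreasing, its fixed point moves by at most the distance of the offspring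
distributions. -/
lemma winProb_sub_le (hp : p ∈ drawFree r) (hq : q ∈ drawFree r) :
    winProb r q - winProb r p ≤ dist q p := by
  rcases le_total (winProb r q) (winProb r p) with h | h
  · exact (sub_nonpos.2 h).trans dist_nonneg
  · have h1 := one_sub_gen_winProb hp
    have h2 := one_sub_gen_winProb hq
    have h3 := (isSubProb_weight r p).gen_mono winProb_mem.1 h winProb_mem.2
    have h4 := abs_le.1 (abs_gen_sub_le (r := r) (p := p) (q := q)
      (winProb_mem (r := r) (p := q)).1 winProb_mem.2)
    linarith [h4.1]

lemma tendsto_winProb (hf : Tendsto f l (𝓝 p)) (hp : p ∈ drawFree r)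
    (hfd : ∀ i, f i ∈ drawFree r) : Tendsto (fun i => winProb r (f i)) l (𝓝 (winProb r p)) := by
  refine tendsto_iff_dist_tendsto_zero.2
    (squeeze_zero (fun _ => dist_nonneg) (fun i => ?_) (tendsto_iff_dist_tendsto_zero.1 hf))
  rw [Real.dist_eq, abs_le]
  have h1 := winProb_sub_le hp (hfd i)
  have h2 := winProb_sub_le (hfd i) hp
  rw [dist_comm] at h2
  exact ⟨by linarith, h1⟩

lemma tendsto_forcedWinProb (hf : Tendsto f l (𝓝 p)) (hp : p ∈ drawFree r)
    (hfd : ∀ i, f i ∈ drawFree r) (hx : winProb r p < 1) (n : ℕ) :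
    Tendsto (fun i => forcedWinProb r (f i) n) l (𝓝 (forcedWinProb r p n)) := by
  have hX := tendsto_winProb hf hp hfd
  have key : Tendsto (fun i => forcedWinProb r (f i) n) l (𝓝 (forcedWinProb r p n)) ∧
      Tendsto (fun i => forcedLossProb r (f i) n) l (𝓝 (forcedLossProb r p n)) := by
    induction n with
    | zero =>
      simp only [forcedWinProb_zero, forcedLossProb_zero, mem_drawFree_iff.1 hp,
        fun i => mem_drawFree_iff.1 (hfd i)]
      exact ⟨hX, hX.const_sub 1⟩
    | succ n ih =>
      simp only [forcedWinProb_succ, forcedLossProb_succ]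
      refine ⟨(tendsto_genDeriv hf hX (fun i => winProb_mem.1) winProb_mem.1 hx).mul ih.2,
        (tendsto_gen hf hX (fun i => winProb_mem) winProb_mem).sub
          (tendsto_gen hf (hX.sub ih.1) (fun i => ?_) ?_)⟩
      all_goals exact ⟨sub_nonneg.2 (forcedWinProb_le n),
        (sub_le_self _ (forcedWinProb_nonneg n)).trans winProb_mem.2⟩
  exact key.1

/-- A form of Fatou's lemma for series. -/
lemma tendsto_tsum_nhds_top {F : ι → ℕ → ℝ≥0∞} {F₀ : ℕ → ℝ≥0∞}
    (h : ∀ n, Tendsto (fun i => F i n) l (𝓝 (F₀ n))) (h0 : ∑' n, F₀ n = ∞) :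
    Tendsto (fun i => ∑' n, F i n) l (𝓝 ∞) := by
  refine ENNReal.tendsto_nhds_top_iff_nnreal.2 fun c => ?_
  obtain ⟨s, hs⟩ : ∃ s : Finset ℕ, (c : ℝ≥0∞) < ∑ n ∈ s, F₀ n := by
    rw [← lt_iSup_iff, ← ENNReal.tsum_eq_iSup_sum, h0]
    exact ENNReal.coe_lt_top
  have ht := tendsto_finsetSum s fun n _ => h n
  exact (ht.eventually_const_lt hs).mono fun i hi => hi.trans_le (ENNReal.sum_le_tsum s)

end tendsto

/-! ### The subcritical case -/

lemma gap_nonneg (n : ℕ) : 0 ≤ notLoseProbIn r p n - winProbIn r p n := by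
  rw [← measureReal_undecided]; exact measureReal_nonneg

/-- If the derivative of the generating function is less than one up to a point that is not smaller
than one of the probabilities `notLoseProbIn`, then the iteration is a contraction from there
on. -/
lemma summable_gap {N : ℕ} (hx1 : x < 1) (hN : notLoseProbIn r p N ≤ x)
    (h : genDeriv (weight r p) x < 1) :
    Summable fun n => notLoseProbIn r p n - winProbIn r p n := by
  have hg := isSubProb_weight r p
  refine summable_of_ratio_norm_eventually_le h (eventually_atTop.2 ⟨N, fun n hn => ?_⟩)
  have hb : notLoseProbIn r p n ≤ x := (notLoseProbIn_anti hn).trans hN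
  have hab : winProbIn r p n ≤ notLoseProbIn r p n := sub_nonneg.1 (gap_nonneg n)
  rw [Real.norm_of_nonneg (gap_nonneg _), Real.norm_of_nonneg (gap_nonneg _),
    notLoseProbIn_succ, winProbIn_succ, sub_sub_sub_cancel_left]
  exact (hg.gen_sub_le (winProbIn_mem n).1 hab (hb.trans_lt hx1)).trans
    (mul_le_mul_of_nonneg_right (hg.genDeriv_mono (notLoseProbIn_mem n).1 hb hx1) (gap_nonneg n))

lemma mem_drawFree_of_summable
    (h : Summable fun n => notLoseProbIn r p n - winProbIn r p n) : p ∈ drawFree r := by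
  rw [mem_drawFree_iff, ← sub_eq_zero]
  exact tendsto_nhds_unique (tendsto_notLoseProbIn.sub tendsto_winProbIn)
    h.tendsto_atTop_zero

lemma meanGameLength_lt_top
    (h : Summable fun n => notLoseProbIn r p n - winProbIn r p n) :
    meanGameLength r p < ∞ := by
  have h1 : Summable fun n => notLoseProbIn r p (n + 1) - winProbIn r p (n + 1) :=
    (summable_nat_add_iff (f := fun n => notLoseProbIn r p n - winProbIn r p n) 1).2 h
  rw [meanGameLength_eq, ← ENNReal.ofReal_tsum_of_nonneg (fun n => gap_nonneg (n + 1)) h1]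
  exact ENNReal.ofReal_lt_top

lemma exists_contraction_point (hp : p ∈ drawFree r) (hx1 : winProb r p < 1)
    (h : genDeriv (weight r p) (winProb r p) < 1) :
    ∃ x N, 0 ≤ x ∧ x < 1 ∧ notLoseProbIn r p N < x ∧ genDeriv (weight r p) x < 1 := by
  have ht : Tendsto (fun n : ℕ => winProb r p + 1 / ((n : ℝ) + 1)) atTop (𝓝 (winProb r p)) := by
    simpa using tendsto_one_div_add_atTop_nhds_zero_nat.const_add (winProb r p)
  have h0 : ∀ n : ℕ, 0 ≤ winProb r p + 1 / ((n : ℝ) + 1) := fun n =>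
    add_nonneg winProb_mem.1 (by positivity)
  obtain ⟨n, hn1, hn2⟩ := ((ht.eventually_lt_const hx1).and
    ((tendsto_genDeriv (r := r) tendsto_const_nhds ht h0 winProb_mem.1 hx1).eventually_lt_const
      h)).exists
  have hlt : notLoseProb r p < winProb r p + 1 / ((n : ℝ) + 1) := by
    rw [mem_drawFree_iff.1 hp]
    exact lt_add_of_pos_right _ (by positivity)
  obtain ⟨N, hN⟩ := (tendsto_notLoseProbIn.eventually_lt_const hlt).exists
  exact ⟨_, N, h0 n, hn1, hN, hn2⟩

lemma mem_interior_drawFree (hp : p ∈ drawFree r) (hx1 : winProb r p < 1)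
    (h : genDeriv (weight r p) (winProb r p) < 1) : p ∈ interior (drawFree r) := by
  obtain ⟨x, N, hx0, hx1, hN, hx⟩ := exists_contraction_point hp hx1 h
  rw [mem_interior_iff_mem_nhds]
  filter_upwards [(tendsto_winProbIn_and_notLoseProbIn (r := r) (f := id) tendsto_id
    N).2.eventually_lt_const hN, (tendsto_genDeriv (r := r) (f := id) (y := fun _ => x) tendsto_id
    tendsto_const_nhds (fun _ => hx0) hx0 hx1).eventually_lt_const hx] with q hq1 hq2
  exact mem_drawFree_of_summable (summable_gap hx1 hq1.le hq2)

/-- The player to move wins with probability one only in the misère game on a single vertex. -/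
lemma eq_misere_of_winProb_eq_one (h : winProb r p = 1) :
    (∀ k, weight r p k = 0) ∧ r = .misere ∧ p 0 = 1 := by
  have hg := isSubProb_weight r p
  have hY : notLoseProb r p = 1 :=
    le_antisymm notLoseProb_mem.2 (h ▸ winProb_le_notLoseProb)
  have h1 := winProb_eq (r := r) (p := p)
  rw [h, hY, IsSubProb.gen_one] at h1
  have h2 : ∑' k, weight r p k = 0 := by linarith
  have hw : ∀ k, weight r p k = 0 := fun k =>
    congrFun ((hasSum_zero_iff_of_nonneg hg.nonneg).1 (h2 ▸ hg.summable.hasSum)) k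
  have hp : ∀ k ≠ 0, p k = 0 := fun k hk => by
    have := hw k
    rw [weight_of_ne_zero hk] at this
    exact ((ENNReal.toReal_eq_zero_iff _).1 this).resolve_right (p.apply_ne_top k)
  have hp0 : p 0 = 1 := by rw [← p.tsum_coe, tsum_eq_single 0 hp]
  refine ⟨hw, ?_, hp0⟩
  by_contra hr
  simpa [weight, hr, hp0] using hw 0

/-! ### The critical and supercritical cases -/

/-- Near a fixed point at which the derivative of `1 - gen` is less than `-1`, the iterates move
away from the fixed point, so that they cannot converge to it. -/
lemma notMem_drawFree (hx0 : 0 < x) (hx1 : x < 1) (hfix : gen (weight r p) x = 1 - x)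
    (h : 1 < genDeriv (weight r p) x) : p ∉ drawFree r := by
  intro hp
  have hg := isSubProb_weight r p
  obtain ⟨k, hk, hgk⟩ := hg.exists_pos_of_genDeriv_pos (zero_lt_one.trans h)
  have hmem : ∀ n, winProbIn r p n < x ∧ x < notLoseProbIn r p n := by
    intro n
    induction n with
    | zero => simp [hx0, hx1]
    | succ n ih =>
      have h1 := hg.gen_lt (winProbIn_mem n).1 ih.1 hx1.le hk hgk
      have h2 := hg.gen_lt hx0.le ih.2 (notLoseProbIn_mem n).2 hk hgk
      rw [winProbIn_succ, notLoseProbIn_succ]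
      constructor <;> linarith
  have hX : winProb r p = x := by
    have h1 := le_of_tendsto' tendsto_winProbIn fun n => (hmem n).1.le
    have h2 := ge_of_tendsto' tendsto_notLoseProbIn fun n => (hmem n).2.le
    rw [mem_drawFree_iff.1 hp] at h2
    exact h1.antisymm h2
  have hd : Tendsto (fun n => x - winProbIn r p n) atTop (𝓝 0) := by
    simpa [hX] using tendsto_winProbIn (r := r) (p := p) |>.const_sub x
  have hC : Tendsto (fun n => 2 / (1 - x) ^ 2 * (x - winProbIn r p n)) atTop (𝓝 0) := by
    simpa using hd.const_mul (2 / (1 - x) ^ 2)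
  obtain ⟨N, hN⟩ := eventually_atTop.1 (hC.eventually_lt_const (sub_pos.2 h))
  have hstep : ∀ n ≥ N, x - winProbIn r p n ≤ x - winProbIn r p (n + 2) := by
    intro n hn
    have h1 := hg.gen_sub_ge (winProbIn_mem n).1 (hmem n).1.le hx1
    have h2 := hg.le_gen_sub hx0.le (hmem (n + 1)).2.le hx1 (notLoseProbIn_mem (n + 1)).2
    have h3 := winProbIn_succ (r := r) (p := p) (n + 1)
    have h4 := notLoseProbIn_succ (r := r) (p := p) n
    have h5 := mul_le_mul_of_nonneg_right (hN n hn).le (sub_nonneg.2 (hmem n).1.le)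
    have h6 := mul_le_mul_of_nonneg_right h.le (sub_nonneg.2 (hmem (n + 1)).2.le)
    have h7 : winProbIn r p (n + 2) = 1 - gen (weight r p) (notLoseProbIn r p (n + 1)) := h3
    nlinarith
  have hall : ∀ m, x - winProbIn r p N ≤ x - winProbIn r p (N + 2 * m) := by
    intro m
    induction m with
    | zero => simp
    | succ m ih => exact ih.trans (hstep (N + 2 * m) (by omega))
  have hsub : Tendsto (fun m => N + 2 * m) atTop atTop :=
    tendsto_atTop_mono (fun m => (by omega : m ≤ N + 2 * m)) tendsto_id
  have := ge_of_tendsto' (hd.comp hsub) hall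
  linarith [(hmem N).1]

/-- A sequence of positive numbers that decreases by no more than a multiple of its square decays
no faster than the harmonic sequence. -/
lemma not_summable_of_sq_le {e : ℕ → ℝ} {C : ℝ} (hC : 0 ≤ C) (hpos : ∀ n, 0 < e n)
    (h : ∀ n, e n - C * e n ^ 2 ≤ e (n + 1)) : ¬ Summable e := by
  intro hs
  have h0 : Tendsto (fun n => C * e n) atTop (𝓝 0) := by
    simpa using hs.tendsto_atTop_zero.const_mul C
  obtain ⟨N, hN⟩ := eventually_atTop.1 (h0.eventually_lt_const (show (0 : ℝ) < 1 / 2 by norm_num))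
  have hinv : ∀ m, (e (N + m))⁻¹ ≤ (e N)⁻¹ + 2 * C * m := by
    intro m
    induction m with
    | zero => simp
    | succ m ih =>
      have h1 := h (N + m)
      have h2 := hN (N + m) (by omega)
      have h3 := hpos (N + m)
      have h4 : (e (N + m + 1))⁻¹ ≤ (e (N + m))⁻¹ + 2 * C := by
        have hne := h3.ne'
        rw [inv_le_iff_one_le_mul₀ (hpos _)]
        have h5 : 0 ≤ (e (N + m))⁻¹ + 2 * C := by positivity
        refine le_trans ?_ (mul_le_mul_of_nonneg_left h1 h5)
        have h6 : ((e (N + m))⁻¹ + 2 * C) * (e (N + m) - C * e (N + m) ^ 2) =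
            1 + C * e (N + m) * (1 - 2 * (C * e (N + m))) := by
          field_simp
          ring
        rw [h6]
        have : 0 ≤ C * e (N + m) * (1 - 2 * (C * e (N + m))) :=
          mul_nonneg (by positivity) (by linarith)
        linarith
      rw [← add_assoc N m 1]
      push_cast
      linarith
  have hs' : Summable fun m => e (N + m) := by
    simpa only [add_comm N] using (summable_nat_add_iff N).2 hs
  -- Comparison with the harmonic series.
  set A := (e N)⁻¹ + 2 * C with hA
  have hA0 : 0 < A := by have := hpos N; positivity
  have hle : ∀ m : ℕ, 1 / ((m : ℝ) + 1) * A⁻¹ ≤ e (N + m) := by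
    intro m
    have h1 : (e (N + m))⁻¹ ≤ A * (m + 1) := by
      refine (hinv m).trans ?_
      have := hpos N
      have h2 : 0 ≤ (e N)⁻¹ * m := by positivity
      rw [hA]
      nlinarith
    rw [one_div, ← mul_inv, mul_comm]
    exact inv_le_of_inv_le₀ (hpos _) h1
  have hharm : Summable fun m : ℕ => 1 / ((m : ℝ) + 1) := by
    have := Summable.of_nonneg_of_le (fun m : ℕ => by positivity) hle hs'
    exact (summable_mul_right_iff (inv_ne_zero hA0.ne')).1 this
  refine Real.not_summable_one_div_natCast ((summable_nat_add_iff 1).1 ?_)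
  simpa using hharm

lemma half_le_winProb (hp : p ∈ drawFree r) (hx1 : winProb r p < 1)
    (h : 1 ≤ genDeriv (weight r p) (winProb r p)) : 1 / 2 ≤ winProb r p := by
  have hg := isSubProb_weight r p
  have h1 := hg.le_gen_sub winProb_mem.1 hx1.le hx1 le_rfl
  have h2 := one_sub_gen_winProb hp
  have h3 := hg.gen_le_one zero_le_one le_rfl
  have h4 := mul_le_mul_of_nonneg_right h (sub_nonneg.2 hx1.le)
  linarith

lemma not_summable_forcedWinProb (hp : p ∈ drawFree r) (hx1 : winProb r p < 1)
    (h : 1 ≤ genDeriv (weight r p) (winProb r p)) : ¬ Summable (forcedWinProb r p) := by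
  have hg := isSubProb_weight r p
  have hx0 : 0 < winProb r p := by linarith [half_le_winProb hp hx1 h]
  obtain ⟨k, hk, hgk⟩ := hg.exists_pos_of_genDeriv_pos (zero_lt_one.trans_le h)
  have hw : ∀ n, forcedLossProb r p n ≤ forcedWinProb r p (n + 1) := fun n => by
    rw [forcedWinProb_succ]
    exact le_mul_of_one_le_left measureReal_nonneg h
  have hpos : ∀ m, 0 < forcedWinProb r p (2 * m) := by
    intro m
    induction m with
    | zero => simpa [forcedWinProb_zero] using hx0
    | succ m ih =>
      refine lt_of_lt_of_le ?_ (hw (2 * m + 1))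
      rw [forcedLossProb_succ, sub_pos]
      exact hg.gen_lt (sub_nonneg.2 (forcedWinProb_le _)) (sub_lt_self _ ih) hx1.le hk hgk
  intro hs
  refine not_summable_of_sq_le (e := fun m => forcedWinProb r p (2 * m))
    (C := 2 / (1 - winProb r p) ^ 2) (by positivity) hpos (fun m => ?_)
    (hs.comp_injective (mul_right_injective₀ two_ne_zero))
  have h1 := hw (2 * m + 1)
  rw [forcedLossProb_succ] at h1
  have h2 := hg.gen_sub_ge (sub_nonneg.2 (forcedWinProb_le (2 * m)))
    (sub_le_self _ (forcedWinProb_nonneg (2 * m))) hx1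
  rw [sub_sub_cancel] at h2
  have h3 := mul_le_mul_of_nonneg_right h (forcedWinProb_nonneg (r := r) (p := p) (2 * m))
  have h4 : forcedWinProb r p (2 * (m + 1)) = forcedWinProb r p (2 * m + 1 + 1) := rfl
  rw [h4]
  linarith

lemma tsum_forcedWinProb_eq_top (hp : p ∈ drawFree r) (hx1 : winProb r p < 1)
    (h : 1 ≤ genDeriv (weight r p) (winProb r p)) :
    ∑' n, ENNReal.ofReal (forcedWinProb r p (n + 1)) = ∞ := by
  by_contra hne
  refine not_summable_forcedWinProb hp hx1 h ((summable_nat_add_iff 1).1 ?_)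
  refine (ENNReal.summable_toReal hne).congr fun n => ?_
  exact ENNReal.toReal_ofReal (forcedWinProb_nonneg _)

end TreeGame

namespace TreeGame

variable {r : Rule} {p q s : PMF ℕ} {x t : ℝ}

/-! ### Perturbation of the offspring distribution -/

/-- The mixture `(1 - t) p + t s` of two distributions. -/
noncomputable def mix (p s : PMF ℕ) (t : ℝ) (ht0 : 0 ≤ t) (ht1 : t ≤ 1) : PMF ℕ :=
  ⟨fun k => ENNReal.ofReal ((1 - t) * (p k).toReal + t * (s k).toReal), by
    have h1 : ∀ k, 0 ≤ (1 - t) * (p k).toReal + t * (s k).toReal := fun k =>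
      add_nonneg (mul_nonneg (sub_nonneg.2 ht1) ENNReal.toReal_nonneg)
        (mul_nonneg ht0 ENNReal.toReal_nonneg)
    have h2 := ((offspring_summable p).mul_left (1 - t))
    have h3 := ((offspring_summable s).mul_left t)
    have h4 : ∑' k, ((1 - t) * (p k).toReal + t * (s k).toReal) = 1 := by
      rw [h2.tsum_add h3, tsum_mul_left, tsum_mul_left, tsum_toReal, tsum_toReal]
      ring
    have h5 := ENNReal.ofReal_tsum_of_nonneg h1 (h2.add h3)
    rw [h4, ENNReal.ofReal_one] at h5
    exact h5 ▸ ENNReal.summable.hasSum⟩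

section mix

variable {ht0 : 0 ≤ t} {ht1 : t ≤ 1}

lemma toReal_mix (k : ℕ) :
    (mix p s t ht0 ht1 k).toReal = (1 - t) * (p k).toReal + t * (s k).toReal :=
  ENNReal.toReal_ofReal (add_nonneg (mul_nonneg (sub_nonneg.2 ht1) ENNReal.toReal_nonneg)
    (mul_nonneg ht0 ENNReal.toReal_nonneg))

lemma weight_mix (k : ℕ) :
    weight r (mix p s t ht0 ht1) k = (1 - t) * weight r p k + t * weight r s k := by
  unfold weight
  split_ifs
  · simp
  · exact toReal_mix k

lemma gen_mix (hx0 : 0 ≤ x) (hx1 : x ≤ 1) : gen (weight r (mix p s t ht0 ht1)) x =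
    (1 - t) * gen (weight r p) x + t * gen (weight r s) x := by
  simp only [gen, weight_mix, add_mul, mul_assoc]
  rw [(((isSubProb_weight r p).summable_gen hx0 hx1).mul_left (1 - t)).tsum_add
    (((isSubProb_weight r s).summable_gen hx0 hx1).mul_left t), tsum_mul_left, tsum_mul_left]

lemma genDeriv_mix (hx0 : 0 ≤ x) (hx1 : x < 1) : genDeriv (weight r (mix p s t ht0 ht1)) x =
    (1 - t) * genDeriv (weight r p) x + t * genDeriv (weight r s) x := by
  simp only [genDeriv, weight_mix, add_mul, mul_assoc]
  rw [(((isSubProb_weight r p).summable_genDeriv hx0 hx1).mul_left (1 - t)).tsum_add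
    (((isSubProb_weight r s).summable_genDeriv hx0 hx1).mul_left t), tsum_mul_left,
    tsum_mul_left]

lemma dist_mix_le : dist (mix p s t ht0 ht1) p ≤ 2 * t := by
  have h1 : ∀ k, |(mix p s t ht0 ht1 k).toReal - (p k).toReal| ≤
      t * ((s k).toReal + (p k).toReal) := fun k => by
    rw [toReal_mix, show (1 - t) * (p k).toReal + t * (s k).toReal - (p k).toReal =
      t * ((s k).toReal - (p k).toReal) by ring, abs_mul, abs_of_nonneg ht0]
    refine mul_le_mul_of_nonneg_left ?_ ht0
    have h2 : 0 ≤ (s k).toReal := ENNReal.toReal_nonneg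
    have h3 : 0 ≤ (p k).toReal := ENNReal.toReal_nonneg
    rw [abs_le]
    constructor <;> linarith
  have hs := (offspring_summable s).add (offspring_summable p)
  refine ((offspring_summable_diff _ p).tsum_le_tsum h1 (hs.mul_left t)).trans (le_of_eq ?_)
  rw [tsum_mul_left, (offspring_summable s).tsum_add (offspring_summable p), tsum_toReal,
    tsum_toReal]
  ring

end mix

lemma weight_pure {j : ℕ} (hj : j ≠ 0) (k : ℕ) :
    weight r (PMF.pure j) k = if k = j then 1 else 0 := by
  rcases eq_or_ne k 0 with rfl | hk
  · simp [weight, hj.symm]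
  · rw [weight_of_ne_zero hk, PMF.pure_apply]
    split_ifs <;> simp

lemma gen_pure {j : ℕ} (hj : j ≠ 0) : gen (weight r (PMF.pure j)) x = x ^ j := by
  simp [gen, weight_pure hj]

lemma genDeriv_pure {j : ℕ} (hj : j ≠ 0) :
    genDeriv (weight r (PMF.pure j)) x = j * x ^ (j - 1) := by
  simp [genDeriv, weight_pure hj]

/-- A supercritical distribution with a prescribed fixed point `x > 1 / 2`. It is a mixture of the
point masses at `1` and at the least `k` with `x ^ k ≤ 1 - x`. -/
lemma exists_supercritical (r : Rule) (hx : 1 / 2 < x) (hx1 : x < 1) :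
    ∃ s : PMF ℕ, gen (weight r s) x = 1 - x ∧ 1 < genDeriv (weight r s) x := by
  classical
  have hx0 : 0 < x := by linarith
  have hex : ∃ k, x ^ k ≤ 1 - x :=
    (exists_pow_lt_of_lt_one (sub_pos.2 hx1) hx1).imp fun k hk => hk.le
  obtain ⟨m, hm⟩ : ∃ m, Nat.find hex = m + 2 := by
    have h0 : Nat.find hex ≠ 0 := fun h => by
      have := Nat.find_spec hex
      rw [h, pow_zero] at this
      linarith
    have h1 : Nat.find hex ≠ 1 := fun h => by
      have := Nat.find_spec hex
      rw [h, pow_one] at this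
      linarith
    exact ⟨Nat.find hex - 2, by omega⟩
  have hk1 : x ^ (m + 2) ≤ 1 - x := hm ▸ Nat.find_spec hex
  have hk2 : 1 - x < x ^ (m + 1) :=
    not_le.1 (Nat.find_min hex (by omega : m + 1 < Nat.find hex))
  -- By Bernoulli's inequality the point mass at `m + 2` has a large derivative at `x`.
  have hder : 1 < ((m + 2 : ℕ) : ℝ) * x ^ (m + 1) := by
    have hB := one_add_mul_le_pow (show (-2 : ℝ) ≤ x - 1 by linarith) (m + 1)
    rw [add_sub_cancel] at hB
    have := mul_lt_mul_of_pos_left hk2 (show (0 : ℝ) < ((m + 1 : ℕ) : ℝ) by positivity)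
    push_cast at *
    linarith
  have hpos : 0 < x - x ^ (m + 2) := by linarith
  set t := (2 * x - 1) / (x - x ^ (m + 2)) with ht
  have ht0 : 0 < t := div_pos (by linarith) hpos
  have ht1 : t ≤ 1 := (div_le_one hpos).2 (by linarith)
  have htm : t * (x - x ^ (m + 2)) = 2 * x - 1 := div_mul_cancel₀ _ hpos.ne'
  refine ⟨mix (PMF.pure 1) (PMF.pure (m + 2)) t ht0.le ht1, ?_, ?_⟩
  · rw [gen_mix hx0.le hx1.le, gen_pure one_ne_zero, gen_pure (by omega), pow_one]
    linarith
  · rw [genDeriv_mix hx0.le hx1, genDeriv_pure one_ne_zero, genDeriv_pure (by omega)]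
    have := mul_lt_mul_of_pos_left hder ht0
    simp only [Nat.cast_one, Nat.sub_self, pow_zero, mul_one] at *
    rw [show m + 2 - 1 = m + 1 by omega]
    linarith

/-- A critical fixed point at `1 / 2` would make the generating function linear, and then
`1 - gen` exchanges `0` and `1`. -/
lemma winProb_ne_half (hp : p ∈ drawFree r) (h : 1 ≤ genDeriv (weight r p) (winProb r p)) :
    winProb r p ≠ 1 / 2 := by
  intro hx
  have hg := isSubProb_weight r p
  have hfix := one_sub_gen_winProb hp
  rw [hx] at h hfix
  have hterm : ∀ k : ℕ, 0 ≤ (1 : ℝ) - (1 / 2) ^ k - k * (1 / 2) ^ (k - 1) * (1 - 1 / 2) := by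
    intro k
    have := le_pow_sub_pow (x := 1) (y := 1 / 2) (by norm_num) (by norm_num) k
    rw [one_pow] at this
    linarith
  have hs1 := hg.summable
  have hs2 := hg.summable_gen (y := 1 / 2) (by norm_num) (by norm_num)
  have hs3 := (hg.summable_genDeriv (y := 1 / 2) (by norm_num) (by norm_num)).mul_right (1 / 2)
  have hsum := (hs1.hasSum.sub hs2.hasSum).sub hs3.hasSum
  have hnn : ∀ k : ℕ, 0 ≤ weight r p k - weight r p k * (1 / 2) ^ k -
      weight r p k * (k * (1 / 2) ^ (k - 1)) * (1 / 2) := fun k => by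
    have := mul_nonneg (hg.nonneg k) (hterm k)
    nlinarith
  have hval : ∑' k, weight r p k - ∑' k, weight r p k * (1 / 2) ^ k -
      ∑' k : ℕ, weight r p k * (k * (1 / 2) ^ (k - 1)) * (1 / 2) = 0 := by
    refine le_antisymm ?_ (hsum.tsum_eq ▸ tsum_nonneg hnn)
    have h1 := hg.tsum_le_one
    rw [tsum_mul_right]
    rw [gen] at hfix
    rw [genDeriv] at h
    linarith
  rw [hval] at hsum
  have hz := fun k => congrFun ((hasSum_zero_iff_of_nonneg hnn).1 hsum) k
  have hw : ∀ k ≠ 0, k ≠ 1 → weight r p k = 0 := by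
    intro k hk0 hk1
    obtain ⟨m, rfl⟩ : ∃ m, k = m + 2 := ⟨k - 2, by omega⟩
    have h1 := hz (m + 2)
    have h2 : ((m + 2 : ℕ) : ℝ) + 1 < 2 ^ (m + 2) := by
      have : ∀ j : ℕ, j + 3 < 2 ^ (j + 2) := fun j => by
        induction j with
        | zero => norm_num
        | succ j ih => rw [pow_succ]; omega
      exact_mod_cast this m
    have h3 : (1 : ℝ) - (1 / 2) ^ (m + 2) - ((m + 2 : ℕ) : ℝ) * (1 / 2) ^ (m + 1) * (1 / 2) ≠ 0 := by
      have h4 : (0 : ℝ) < (1 / 2) ^ (m + 2) := by positivity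
      have h5 : (2 : ℝ) ^ (m + 2) * (1 / 2) ^ (m + 2) = 1 := by
        rw [← mul_pow]; norm_num
      have h6 : (1 / 2 : ℝ) ^ (m + 1) * (1 / 2) = (1 / 2) ^ (m + 2) := (pow_succ _ _).symm
      rw [mul_assoc, h6]
      nlinarith
    have h7 : weight r p (m + 2) *
        ((1 : ℝ) - (1 / 2) ^ (m + 2) - ((m + 2 : ℕ) : ℝ) * (1 / 2) ^ (m + 1) * (1 / 2)) = 0 := by
      rw [Pi.zero_apply] at h1
      rw [← h1]
      simp only [show m + 2 - 1 = m + 1 by omega]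
      ring
    exact (mul_eq_zero.1 h7).resolve_right h3
  have hd : genDeriv (weight r p) (1 / 2) = weight r p 1 := by
    rw [genDeriv, tsum_eq_single 1]
    · simp
    · intro k hk
      rcases eq_or_ne k 0 with rfl | hk0
      · simp
      · rw [hw k hk0 hk, zero_mul]
  have htot : weight r p 0 + weight r p 1 = ∑' k, weight r p k := by
    rw [tsum_eq_sum (s := Finset.range 2) fun k hk => hw k
      (by rintro rfl; simp at hk) (by rintro rfl; simp at hk)]
    simp [Finset.sum_range_succ]
  have hw1 : weight r p 1 = 1 := by
    have := hg.nonneg 0; have := hg.tsum_le_one; linarith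
  have hw0 : weight r p 0 = 0 := by
    have := hg.nonneg 0; have := hg.tsum_le_one; linarith
  have hgen : ∀ y, gen (weight r p) y = y := fun y => by
    rw [gen, tsum_eq_single 1, hw1, pow_one, one_mul]
    intro k hk
    rcases eq_or_ne k 0 with rfl | hk0
    · simp [hw0]
    · rw [hw k hk0 hk, zero_mul]
  have hall : ∀ n, winProbIn r p n = 0 ∧ notLoseProbIn r p n = 1 := by
    intro n
    induction n with
    | zero => simp
    | succ n ih => simp [winProbIn_succ, notLoseProbIn_succ, hgen, ih.1, ih.2]
  have := le_of_tendsto' (tendsto_winProbIn (r := r) (p := p)) fun n => (hall n).1.le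
  rw [hx] at this
  norm_num at this

/-- A critical offspring distribution can be mixed with a supercritical one that has the same
fixed point. -/
lemma notMem_interior_drawFree (hp : p ∈ drawFree r) (hx1 : winProb r p < 1)
    (h : 1 ≤ genDeriv (weight r p) (winProb r p)) : p ∉ interior (drawFree r) := by
  intro hint
  obtain ⟨ε, hε, hball⟩ := Metric.mem_nhds_iff.1 (mem_interior_iff_mem_nhds.1 hint)
  have hhalf : 1 / 2 < winProb r p :=
    lt_of_le_of_ne (half_le_winProb hp hx1 h) (winProb_ne_half hp h).symm
  have hx0 : 0 < winProb r p := by linarith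
  obtain ⟨s, hs1, hs2⟩ := exists_supercritical r hhalf hx1
  set t := min 1 (ε / 4) with ht
  have ht0 : 0 < t := lt_min one_pos (by linarith)
  have ht1 : t ≤ 1 := min_le_left _ _
  have htε : t ≤ ε / 4 := min_le_right _ _
  have hmem : mix p s t ht0.le ht1 ∈ drawFree r := hball (by
    rw [Metric.mem_ball]
    linarith [dist_mix_le (p := p) (s := s) (ht0 := ht0.le) (ht1 := ht1)])
  refine notMem_drawFree hx0 hx1 ?_ ?_ hmem
  · have := one_sub_gen_winProb hp
    rw [gen_mix hx0.le hx1.le, hs1]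
    linear_combination (1 - t) * (-this)
  · rw [genDeriv_mix hx0.le hx1]
    have h1 := mul_le_mul_of_nonneg_left h (sub_nonneg.2 ht1)
    have h2 := mul_lt_mul_of_pos_left hs2 ht0
    linarith

/-! ### Expected lengths -/

lemma winProb_lt_one (h : r = .misere → p 0 ≠ 1) : winProb r p < 1 :=
  lt_of_le_of_ne winProb_mem.2 fun h1 =>
    have h2 := (eq_misere_of_winProb_eq_one h1).2
    h h2.1 h2.2

lemma meanGameLength_lt_top_of_mem_interior (hp : p ∈ interior (drawFree r)) :
    meanGameLength r p < ∞ := by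
  have hp' := interior_subset hp
  rcases eq_or_ne (winProb r p) 1 with h1 | h1
  · have hw := (eq_misere_of_winProb_eq_one h1).1
    refine meanGameLength_lt_top ((summable_nat_add_iff 1).1 ?_)
    simp only [winProbIn_succ, notLoseProbIn_succ, gen, hw, zero_mul, tsum_zero, sub_self]
    exact summable_zero
  · have hx1 := lt_of_le_of_ne winProb_mem.2 h1
    have hd : genDeriv (weight r p) (winProb r p) < 1 :=
      not_le.1 fun h => notMem_interior_drawFree hp' hx1 h hp
    obtain ⟨x, N, -, hx1, hN, hx⟩ := exists_contraction_point hp' hx1 hd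
    exact meanGameLength_lt_top (summable_gap hx1 hN.le hx)

lemma one_le_genDeriv_of_mem_frontier (hp : p ∈ frontier (drawFree r) ∩ drawFree r)
    (hx1 : winProb r p < 1) : 1 ≤ genDeriv (weight r p) (winProb r p) :=
  not_lt.1 fun h => hp.1.2 (mem_interior_drawFree hp.2 hx1 h)

lemma tendsto_meanForcingLength (hp : p ∈ frontier (drawFree r) ∩ drawFree r)
    (hr : r = .misere → p 0 ≠ 1) {ι : Type*} {l : Filter ι} {f : ι → PMF ℕ}
    (hfd : ∀ i, f i ∈ drawFree r) (hf : Tendsto f l (𝓝 p)) :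
    Tendsto (fun i => meanForcingLength r (f i)) l (𝓝 ∞) := by
  have hx1 := winProb_lt_one hr
  refine tendsto_nhds_top_mono (tendsto_tsum_nhds_top
    (fun n => ENNReal.tendsto_ofReal (tendsto_forcedWinProb hf hp.2 hfd hx1 (n + 1)))
    (tsum_forcedWinProb_eq_top hp.2 hx1 (one_le_genDeriv_of_mem_frontier hp hx1))) ?_
  exact .of_forall fun i => tsum_forcedWinProb_le

lemma meanForcingLength_eq_top (hp : p ∈ frontier (drawFree r) ∩ drawFree r)
    (hr : r = .misere → p 0 ≠ 1) : meanForcingLength r p = ∞ := by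
  have hx1 := winProb_lt_one hr
  exact top_le_iff.1 ((tsum_forcedWinProb_eq_top hp.2 hx1
    (one_le_genDeriv_of_mem_frontier hp hx1)).symm.le.trans tsum_forcedWinProb_le)

lemma tsum_gap_eq_top (hp : p ∉ drawFree r) :
    ∑' n, ENNReal.ofReal (notLoseProbIn r p (n + 1) - winProbIn r p (n + 1)) = ∞ := by
  have hd : 0 < notLoseProb r p - winProb r p :=
    sub_pos.2 (lt_of_le_of_ne winProb_le_notLoseProb fun h => hp (mem_drawFree_iff.2 h.symm))
  refine top_le_iff.1 (le_trans (le_of_eq ?_) (ENNReal.tsum_le_tsum fun n =>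
    ENNReal.ofReal_le_ofReal (sub_le_sub (le_notLoseProbIn (n + 1)) (winProbIn_le (n + 1)))))
  exact (ENNReal.tsum_const_eq_top_of_ne_zero (ENNReal.ofReal_pos.2 hd).ne').symm

lemma tendsto_meanGameLength_of_notMem (hp : p ∉ drawFree r) {ι : Type*} {l : Filter ι}
    {f : ι → PMF ℕ} (hf : Tendsto f l (𝓝 p)) :
    Tendsto (fun i => meanGameLength r (f i)) l (𝓝 ∞) := by
  simp only [meanGameLength_eq]
  refine tendsto_tsum_nhds_top (fun n => ENNReal.tendsto_ofReal ?_) (tsum_gap_eq_top hp)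
  have h := tendsto_winProbIn_and_notLoseProbIn (r := r) hf (n + 1)
  exact h.2.sub h.1

end TreeGame

theorem theorem6 (r : TreeGame.Rule) :
    -- (i) in the interior
    (∀ p ∈ interior (TreeGame.drawFree r),
      TreeGame.meanGameLength r p < ∞ ∧ TreeGame.meanForcingLength r p < ∞) ∧
    -- (ii) at boundary points with zero draw probability
    (∀ p ∈ frontier (TreeGame.drawFree r) ∩ TreeGame.drawFree r,
      (r = TreeGame.Rule.misere → p 0 ≠ 1) →
      TreeGame.meanGameLength r p = ∞ ∧ TreeGame.meanForcingLength r p = ∞) ∧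
    -- (iii) along sequences that converge to such a point
    (∀ p ∈ frontier (TreeGame.drawFree r) ∩ TreeGame.drawFree r,
      (r = TreeGame.Rule.misere → p 0 ≠ 1) →
      ∀ q : ℕ → PMF ℕ, (∀ m, q m ∈ TreeGame.drawFree r) → Tendsto q atTop (𝓝 p) →
        Tendsto (fun m => TreeGame.meanGameLength r (q m)) atTop (𝓝 ∞) ∧
        Tendsto (fun m => TreeGame.meanForcingLength r (q m)) atTop (𝓝 ∞)) ∧
    -- (iv) along sequences that converge to a boundary point with positive draw probability
    (∀ p ∈ frontier (TreeGame.drawFree r) \ TreeGame.drawFree r,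
      ∀ q : ℕ → PMF ℕ, (∀ m, q m ∈ TreeGame.drawFree r) → Tendsto q atTop (𝓝 p) →
        Tendsto (fun m => TreeGame.meanGameLength r (q m)) atTop (𝓝 ∞)) := by
  refine ⟨fun p hp => ?_, fun p hp hr => ?_, fun p hp hr q hq hqp => ?_, fun p hp q _ hqp =>
    TreeGame.tendsto_meanGameLength_of_notMem hp.2 hqp⟩
  · have h := TreeGame.meanGameLength_lt_top_of_mem_interior hp
    exact ⟨h, TreeGame.meanForcingLength_le_meanGameLength.trans_lt h⟩
  · have h := TreeGame.meanForcingLength_eq_top hp hr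
    exact ⟨top_le_iff.1 (h ▸ TreeGame.meanForcingLength_le_meanGameLength), h⟩
  · have h := TreeGame.tendsto_meanForcingLength hp hr hq hqp
    exact ⟨tendsto_nhds_top_mono h
      (.of_forall fun m => TreeGame.meanForcingLength_le_meanGameLength), h⟩
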